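/- Let $\Omega\subset\mathbb R^n$ be open and let $F:\Omega\to\mathbb R^m$ be a smooth map whose graph $\Sigma=\{(x,F(x)):x\in\Omega\}\subset\mathbb R^{n}\times\mathbb R^m$ is a minimal submanifold (its mean curvature vanishes identically), oriented so that the projection to $\mathbb R^n$ preserves orientation. Suppose $r=\sup_{x\in\Omega}\operatorname{rank} dF|_x\ge 2$ and that at every point of $\Omega$ the singular values $\lambda_1\ge\lambda_2\ge\cdots$ of $dF$ satisfy $$\lambda_j\lambda_k\le\frac1{(r-1)^2}\qquad\text{for all }1\le j<k\le r .$$ Define the $n$-form $\Theta(F)$ on $\Omega\times\mathbb R^m$ as follows. At $p=(x,F(x))\in\Sigma$ write $S=dF|_x$, $G=I_n+S^*S$, $H=I_m+SS^*$, and let $$L(v)=\bigl(G^{-1/2}v,\;S\,G^{-1/2}v\bigr),\qquad L^\perp(w)=\bigl(-S^*H^{-1/2}w,\;H^{-1/2}w\bigr),$$ isometries of $\mathbb R^n$ onto $T_p\Sigma$ and of $\mathbb R^m$ onto the normal space $N_p\Sigma$; put $J=L^\perp\circ S\circ L^{-1}:T_p\Sigma\to N_p\Sigma$. For a form $\xi$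 at $p$ let $\Psi(\xi)=\sum_{i=1}^n (J e_i)^\flat\wedge\iota_{e_i}\xi$, where $e_1,\dots,e_n$ is an orthonormal basis of $T_p\Sigma$. Let $\operatorname{vol}_\Sigma$ be the volume form of $T_p\Sigma$, extended by zero on $N_p\Sigma$, let $\Psi^\ell(F)=\Psi^\ell(\operatorname{vol}_\Sigma)$, extended to $\Omega\times\mathbb R^m$ by translation in the $\mathbb R^m$-direction, and $$\Theta(F)=\Psi^0(F)-\sum_{\ell\ge1}(-1)^\ell\,\frac{\ell-1}{\ell!}\,\Psi^\ell(F).$$ Then: 1. $\Theta(F)$ is a calibration on $\Omega\times\mathbb R^m$: it is smooth, $d\Theta(F)=0$, and its comass (the supremum of its values on oriented unit $n$-planes) is at most $1$ at every point. 2. $\Theta(F)$ restricts to the volume form on $\Sigma$, so $\Sigma$ is calibrated by $\Theta(F)$. 3. $\Sigma$ is area-minimizing in its homology class in $\Omega\times\mathbb R^m$: for every measurable $B$ whose closure is a compact subset of $\Omega$, the current $T$ of integration over the part of $\Sigma$ above $B$ satisfies $\mathbf M(T)\le\mathbf M(T+\partial S)$ for every $(n+1)$-dimensional current $S$ with compact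 support in $\Omega\times\mathbb R^m$. Here the mass $\mathbf M(T)$ is the supremum of $T(\varphi)$ over smooth compactly supported $n$-forms $\varphi$ on $\Omega\times\mathbb R^m$ of comass at most $1$. -/

import Mathlib

open Set Module TopologicalSpace MeasureTheory
open scoped ContDiff ENNReal Distributions

noncomputable section

namespace GraphCalibration

/-- `ℝⁿ` with its Euclidean inner product. -/
abbrev E (n : ℕ) : Type := EuclideanSpace ℝ (Fin n)

/-- `ℝⁿ × ℝᵐ = ℝⁿ⁺ᵐ` with its Euclidean inner product. -/
abbrev V (n m : ℕ) : Type := EuclideanSpace ℝ (Fin n ⊕ Fin m)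

/-- Constant-coefficient `k`-forms on `ℝⁿ × ℝᵐ`; a differential `k`-form is a map `V n m → Form n m k`. -/
abbrev Form (n m k : ℕ) : Type := V n m [⋀^Fin k]→L[ℝ] ℝ

variable {n m k : ℕ}

/-- The `j`-th standard basis vector of `ℝⁿ`. -/
def stdVec (j : Fin n) : E n := EuclideanSpace.single j 1

/-- The point `(x, y)` of `ℝⁿ × ℝᵐ`. -/
def pair (x : E n) (y : E m) : V n m := WithLp.toLp 2 (Sum.elim x y)

/-- The projection `ℝⁿ × ℝᵐ → ℝⁿ`. -/
def proj (n m : ℕ) : V n m →L[ℝ] E n :=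
  LinearMap.toContinuousLinearMap
    { toFun := fun p => WithLp.toLp 2 fun i => p (Sum.inl i)
      map_add' := fun _ _ => rfl
      map_smul' := fun _ _ => rfl }

/-- The linear map `v ↦ (A v, B v)`. -/
def pairing (A : E k →L[ℝ] E n) (B : E k →L[ℝ] E m) : E k →L[ℝ] V n m :=
  LinearMap.toContinuousLinearMap
    { toFun := fun v => pair (A v) (B v)
      map_add' := fun v w => by ext i; cases i <;> simp [pair]
      map_smul' := fun c v => by ext i; cases i <;> simp [pair] }

/-- The open set `Ω × ℝᵐ`. -/
def cylinder (m : ℕ) (Ω : Opens (E n)) : Opens (V n m) :=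
  ⟨{p | proj n m p ∈ Ω}, Ω.isOpen.preimage (proj n m).continuous⟩

/-! ### The geometry of the graph -/

/-- The graph parametrization `x ↦ (x, F x)`. -/
def graphMap (F : E n → E m) (x : E n) : V n m := pair x (F x)

/-- The tangent space of the graph of `F` at `(x, F x)`. -/
def tangentSpace (F : E n → E m) (x : E n) : Submodule ℝ (V n m) :=
  LinearMap.range (fderiv ℝ (graphMap F) x).toLinearMap

/-- The induced metric `g_{jk}` of the graph, in the coordinates `x`. -/
def inducedMetric (F : E n → E m) (x : E n) : Matrix (Fin n) (Fin n) ℝ :=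
  Matrix.of fun j k =>
    inner ℝ (fderiv ℝ (graphMap F) x (stdVec j)) (fderiv ℝ (graphMap F) x (stdVec k))

/-- The second fundamental form of the graph, in the coordinates `x`: the normal component of the
second derivative of the parametrization. -/
def secondFundamentalForm (F : E n → E m) (x u v : E n) : V n m :=
  (tangentSpace F x)ᗮ.starProjection (fderiv ℝ (fderiv ℝ (graphMap F)) x u v)

/-- The mean curvature vector of the graph at `(x, F x)`: the trace of the second fundamental form
with respect to the induced metric. -/
def meanCurvature (F : E n → E m) (x : E n) : V n m :=
  ∑ j, ∑ k, (inducedMetric F x)⁻¹ j k • secondFundamentalForm F x (stdVec j) (stdVec k)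

/-- The graph of `F` over `Ω` is a minimal submanifold. -/
def IsMinimalGraph (F : E n → E m) (Ω : Opens (E n)) : Prop :=
  ∀ x ∈ Ω, meanCurvature F x = 0

/-! ### The isometries `L`, `L^⊥` and the map `J` -/

/-- The matrix of the differential `dF` at `x`. -/
def jacobian (F : E n → E m) (x : E n) : Matrix (Fin m) (Fin n) ℝ :=
  Matrix.of fun a j => fderiv ℝ F x (stdVec j) a

/-- `G = I + dF^* dF`. -/
def matG (F : E n → E m) (x : E n) : Matrix (Fin n) (Fin n) ℝ :=
  1 + (jacobian F x).transpose * jacobian F x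

/-- `H = I + dF dF^*`. -/
def matH (F : E n → E m) (x : E n) : Matrix (Fin m) (Fin m) ℝ :=
  1 + jacobian F x * (jacobian F x).transpose

/-- The inverse square root `A^{-1/2}` of a positive definite symmetric matrix, by functional
calculus, as an operator on `ℝᵏ`. -/
def invSqrt (A : Matrix (Fin k) (Fin k) ℝ) : E k →L[ℝ] E k :=
  Matrix.toEuclideanCLM (𝕜 := ℝ) (cfc (fun t : ℝ => (√t)⁻¹) A)

/-- `L v = (G^{-1/2} v, dF (G^{-1/2} v))`, an isometry of `ℝⁿ` onto the tangent space. -/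
def L (F : E n → E m) (x : E n) : E n →L[ℝ] V n m :=
  pairing (invSqrt (matG F x)) (fderiv ℝ F x ∘L invSqrt (matG F x))

/-- `L^⊥ w = (-dF^* (H^{-1/2} w), H^{-1/2} w)`, an isometry of `ℝᵐ` onto the normal space. -/
def Lperp (F : E n → E m) (x : E n) : E m →L[ℝ] V n m :=
  pairing (-(ContinuousLinearMap.adjoint (fderiv ℝ F x) ∘L invSqrt (matH F x)))
    (invSqrt (matH F x))

/-- `J = L^⊥ ∘ dF ∘ L⁻¹` on the tangent space, extended by zero to the normal space: since `L` is
an isometry onto the tangent space, its adjoint is `L⁻¹` on the tangent space and zero on the normal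
space. -/
def J (F : E n → E m) (x : E n) : V n m →L[ℝ] V n m :=
  Lperp F x ∘L fderiv ℝ F x ∘L ContinuousLinearMap.adjoint (L F x)

/-! ### The forms `Ψ^ℓ(F)` and `Θ(F)` -/

/-- The wedge product `α ∧ η` of a covector and a `k`-form. -/
def wedgeCovector (α : V n m →L[ℝ] ℝ) (η : Form n m k) : Form n m (k + 1) :=
  ContinuousAlternatingMap.alternatizeUncurryFin (α.smulRight η)

/-- `Ψ ξ = ∑ᵢ (J eᵢ)^♭ ∧ ι_{eᵢ} ξ` at the point `(x, F x)`, where `eᵢ = L (bᵢ)` is the orthonormal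
basis of the tangent space that comes from the standard basis `bᵢ` of `ℝⁿ`. -/
def psi (F : E n → E m) (x : E n) : {k : ℕ} → Form n m k → Form n m k
  | 0, _ => 0
  | _ + 1, ξ => ∑ i : Fin n,
      wedgeCovector (innerSL ℝ (J F x (L F x (stdVec i)))) (ξ.curryLeft (L F x (stdVec i)))

/-- The standard volume form `dx₁ ∧ ⋯ ∧ dxₙ` on `ℝⁿ`. -/
def stdVol (n : ℕ) : E n [⋀^Fin n]→L[ℝ] ℝ :=
  { (EuclideanSpace.basisFun (Fin n) ℝ).toBasis.det with
    cont := by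
      change Continuous fun v => (EuclideanSpace.basisFun (Fin n) ℝ).toBasis.det v
      simp only [Basis.det_apply]
      refine Continuous.matrix_det ?_
      refine continuous_matrix fun i j => ?_
      simp only [Basis.toMatrix_apply, OrthonormalBasis.coe_toBasis_repr_apply,
        EuclideanSpace.basisFun_repr]
      fun_prop }

/-- The volume form `ω¹ ∧ ⋯ ∧ ωⁿ` of the graph at `(x, F x)`, as a form on `ℝⁿ × ℝᵐ`; here
`ωⁱ = ⟨L bᵢ, ·⟩`, which vanishes on the normal space. -/
def volGraph (F : E n → E m) (x : E n) : Form n m n :=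
  (stdVol n).compContinuousLinearMap (ContinuousLinearMap.adjoint (L F x))

/-- `Ψ^ℓ(F) = Ψ^ℓ (vol)`, extended to `Ω × ℝᵐ` so as not to depend on the `ℝᵐ` variable. -/
def psiForm (F : E n → E m) (l : ℕ) (p : V n m) : Form n m n :=
  (psi F (proj n m p))^[l] (volGraph F (proj n m p))

/-- `Θ(F) = Ψ⁰(F) - ∑_{ℓ ≥ 1} (-1)^ℓ (ℓ - 1) / ℓ! Ψ^ℓ(F)`. The sum stops at `n`, because
`Ψ^ℓ(F)` has `ℓ` normal factors among its `n` factors, hence vanishes for `ℓ > n`. -/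
def Theta (F : E n → E m) (p : V n m) : Form n m n :=
  psiForm F 0 p -
    ∑ l ∈ Finset.Icc 1 n, ((-1 : ℝ) ^ l * ((l : ℝ) - 1) / (l.factorial : ℝ)) • psiForm F l p

/-! ### Calibrations -/

/-- The comass of a `k`-form: the supremum of its values on oriented unit `k`-planes (an oriented
`k`-plane and its opposite give values of opposite sign). -/
def comass (η : Form n m k) : ℝ≥0∞ :=
  ⨆ (v : Fin k → V n m) (_ : Orthonormal ℝ v), ‖η v‖ₑ

/-- A calibration on the open set `U`: a smooth closed differential form of comass at most one. -/
structure IsCalibration (U : Opens (V n m)) (Θ : V n m → Form n m k) : Prop where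
  smooth : ContDiffOn ℝ ∞ Θ U
  closed : ∀ p ∈ U, extDeriv Θ p = 0
  comass_le : ∀ p ∈ U, comass (Θ p) ≤ 1

/-- `Θ` restricts on the graph of `F` over `Ω` to the volume form of the graph: it takes the value
`1` on each positively oriented orthonormal basis of each tangent space. The graph has the
orientation for which its projection to `ℝⁿ` preserves orientation. -/
def RestrictsToVolume (F : E n → E m) (Ω : Opens (E n)) (Θ : V n m → Form n m n) : Prop :=
  ∀ x ∈ Ω, ∀ v : Fin n → V n m, (∀ i, v i ∈ tangentSpace F x) → Orthonormal ℝ v →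
    0 < stdVol n (fun i => proj n m (v i)) → Θ (graphMap F x) v = 1

/-! ### Currents and area minimization -/

/-- Smooth `k`-forms with compact support in `U`. -/
abbrev TestForm (U : Opens (V n m)) (k : ℕ) : Type := 𝓓(U, Form n m k)

/-- `k`-dimensional currents in `U`. -/
abbrev Current (U : Opens (V n m)) (k : ℕ) : Type := TestForm U k →L[ℝ] ℝ

/-- The exterior derivative of a test form. -/
def TestForm.d {U : Opens (V n m)} (φ : TestForm U k) : TestForm U (k + 1) where
  toFun := extDeriv φ
  contDiff' := by
    have h : ContDiff ℝ ∞ (fderiv ℝ (φ : V n m → Form n m k)) :=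
      φ.contDiff.fderiv_right (by simp)
    exact (ContinuousAlternatingMap.alternatizeUncurryFinCLM ℝ (V n m) ℝ).contDiff.comp h
  hasCompactSupport' := by
    refine (φ.hasCompactSupport.fderiv ℝ).comp_left (g := fun f =>
      ContinuousAlternatingMap.alternatizeUncurryFinCLM ℝ (V n m) ℝ f) (map_zero _)
  tsupport_subset' := by
    refine (closure_mono ?_).trans ((tsupport_fderiv_subset ℝ).trans φ.tsupport_subset)
    exact Function.support_comp_subset (g := fun f =>
      ContinuousAlternatingMap.alternatizeUncurryFinCLM ℝ (V n m) ℝ f) (map_zero _) _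

/-- The boundary `∂S` of a current: `(∂S)(φ) = S(dφ)`. -/
def boundary {U : Opens (V n m)} (S : Current U (k + 1)) (φ : TestForm U k) : ℝ := S φ.d

/-- The current `S` in `U` has compact support. -/
def HasCompactSupp {U : Opens (V n m)} (S : Current U k) : Prop :=
  ∃ K : Set (V n m), IsCompact K ∧ K ⊆ U ∧
    ∀ φ : TestForm U k, Disjoint (tsupport φ) K → S φ = 0

/-- Integration over the oriented piece of the graph of `F` that lies over `B`. -/
def graphCurrent (F : E n → E m) {U : Opens (V n m)} (B : Set (E n)) (φ : TestForm U n) : ℝ :=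
  ∫ x in B, φ (graphMap F x) fun i => fderiv ℝ (graphMap F) x (stdVec i)

/-- The mass of a functional on test forms: its supremum over all test forms of comass at most
one. The mass of an oriented compact piece of a submanifold is its area. -/
def mass {U : Opens (V n m)} (T : TestForm U k → ℝ) : ℝ≥0∞ :=
  ⨆ (φ : TestForm U k) (_ : ∀ p, comass (φ p) ≤ 1), ENNReal.ofReal (T φ)

/-- The graph of `F` over `Ω` is area-minimizing in its homology class in `Ω × ℝᵐ`: a piece `T` of
the graph that is relatively compact in `Ω × ℝᵐ` satisfies `M(T) ≤ M(T + ∂S)` for each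
`(n+1)`-current `S` with compact support in `Ω × ℝᵐ`. -/
def IsAreaMinimizingGraph (F : E n → E m) (Ω : Opens (E n)) : Prop :=
  ∀ B : Set (E n), MeasurableSet B → IsCompact (closure B) → closure B ⊆ Ω →
    ∀ S : Current (cylinder m Ω) (n + 1), HasCompactSupp S →
      mass (U := cylinder m Ω) (graphCurrent F B) ≤
        mass (fun φ => graphCurrent F B φ + boundary S φ)

end GraphCalibration

end

/-! `Ψ` is the derivation of forms induced by the endomorphism N v = ∑ ⟨J eᵢ, v⟩ eᵢ (`frameOp`),
which kills tangent vectors, sends normal vectors to tangent ones, and so satisfies N² = 0. If v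
consists of n vectors with matrices A of tangential and B of normal components, then `Ψ^ℓ(vol)` at v
is the ℓ-th derivative at 0 of P(t) = vol(v + t N v) = det(A + t S* B). The coefficients of Θ are
such that Θ(v) = P(-1) + P'(-1) (`Theta_apply`). This formula is read in two ways.

Comass: a singular value decomposition of S replaces S* B by diag(c) B' and A by a rotated copy.
Expanding along rows gives P(t) = ± ∑_I t^|I| c_I det A_I, where A_I takes its rows in I from B' and
the others from A, and c_I is the product of the cᵢ over I. In P(-1) + P'(-1) the set I has weight
±(1 - |I|), so singletons drop out. For orthonormal v and |I| ≥ 2 one has |det A| + |det A_I| ≤ 1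
(`abs_det_add_abs_det_mixRows_le`), and the bound on products of singular values gives ∑ (|I| - 1)
c_I ≤ 1 over |I| ≥ 2. Hence |Θ| ≤ |det A| + (1 - |det A|) = 1.

Closedness: with X, Y the ℝⁿ and ℝᵐ components of v, W = √det G and Z = G⁻¹S*(Y - S X), one finds
P(t) = W det(X + (t + 1) Z). So Θ is the part of degree at most one in Z: the Cartan form of the
area integrand W, with momenta p = W G⁻¹ S*. Its coefficients depend on x alone, so dΘ involves only
the divergences ∑ᵢ ∂ᵢ pᵢₐ, which vanish on a minimal graph (`sum_fderiv_momentum`). On tangent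
vectors Z = 0, and Θ reduces to the area form. Minimization is then the calibration argument, tested
against Θ times a cutoff. -/

namespace GraphCalibration

open Matrix

/-! ### Determinant inequalities behind the comass bound. -/

section Determinants

variable {n m : ℕ}

/-- Hadamard's inequality, with the freedom to choose the orthonormal basis: the determinant of an
endomorphism does not depend on it. -/
theorem abs_det_le_prod_norm (M : Matrix (Fin n) (Fin n) ℝ)
    (f : OrthonormalBasis (Fin n) ℝ (E n)) :
    |M.det| ≤ ∏ j, ‖Matrix.toEuclideanCLM (𝕜 := ℝ) M (f j)‖ := by
  have : Fact (finrank ℝ (E n) = n) := ⟨by simp⟩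
  have h := f.toBasis.orientation.abs_volumeForm_apply_le
    (fun j => Matrix.toEuclideanCLM (𝕜 := ℝ) M (f j))
  rw [f.toBasis.orientation.volumeForm_robust f rfl] at h
  have h2 := f.toBasis.det_comp (Matrix.toEuclideanCLM (𝕜 := ℝ) M).toLinearMap f
  have h3 : LinearMap.det (Matrix.toEuclideanCLM (𝕜 := ℝ) M).toLinearMap = M.det := by
    rw [← LinearMap.det_toLin (EuclideanSpace.basisFun (Fin n) ℝ).toBasis M]
    congr 1
  have h4 : f.toBasis.det f = 1 := by
    simpa using f.toBasis.det_self
  rw [h3, h4, mul_one] at h2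
  rw [← h2]
  exact h

/-- The conditions cut out the kernel of n - |I| linear forms, of dimension at least |I|, which has
room for |I| orthonormal vectors; these extend to a basis. -/
theorem exists_orthonormalBasis_orthogonal (A : Matrix (Fin n) (Fin n) ℝ) (I : Finset (Fin n)) :
    ∃ f : OrthonormalBasis (Fin n) ℝ (E n), ∀ j ∈ I, ∀ i ∉ I, (A *ᵥ (f j).ofLp) i = 0 := by
  let T : E n →ₗ[ℝ] ({i // i ∉ I} → ℝ) :=
    { toFun := fun c i => (A *ᵥ c.ofLp) i
      map_add' := fun c d => by ext i; simp [Matrix.mulVec_add]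
      map_smul' := fun c d => by ext i; simp [Matrix.mulVec_smul] }
  have hd : I.card ≤ finrank ℝ (LinearMap.ker T) := by
    have h1 := T.finrank_range_add_finrank_ker
    have h2 : finrank ℝ (LinearMap.range T) ≤ Fintype.card {i // i ∉ I} := by
      simpa using (LinearMap.range T).finrank_le
    have h3 : Fintype.card {i // i ∉ I} = n - I.card := by
      rw [Fintype.card_subtype_compl]; simp
    have h4 : I.card ≤ n := by simpa using I.card_le_univ
    simp only [finrank_euclideanSpace, Fintype.card_fin] at h1
    omega
  let b := stdOrthonormalBasis ℝ (LinearMap.ker T)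
  let e : I ↪ Fin (finrank ℝ (LinearMap.ker T)) :=
    (I.equivFin.toEmbedding).trans (Fin.castLEEmb hd)
  let v : Fin n → E n := fun j => if h : j ∈ I then (b (e ⟨j, h⟩) : E n) else 0
  have hv : Orthonormal ℝ ((I : Set (Fin n)).domRestrict v) := by
    have h1 : Orthonormal ℝ (fun k : I => ((b (e k) : LinearMap.ker T) : E n)) :=
      (b.orthonormal.comp e e.injective).comp_linearIsometry (LinearMap.ker T).subtypeₗᵢ
    have h2 : (I : Set (Fin n)).domRestrict v = fun k : I => ((b (e k) : LinearMap.ker T) : E n) := by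
      funext j
      simp [v]
    rw [h2]
    exact h1
  obtain ⟨f, hf⟩ := hv.exists_orthonormalBasis_extension_of_card_eq (by simp)
  refine ⟨f, fun j hj i hi => ?_⟩
  have h5 : f j ∈ LinearMap.ker T := by
    rw [hf j hj]
    simp only [v, dif_pos hj]
    exact (b _).2
  exact congrFun (LinearMap.mem_ker.1 h5) ⟨i, hi⟩

theorem norm_toEuclideanCLM_sq (M : Matrix (Fin n) (Fin n) ℝ) (c : E n) :
    ‖Matrix.toEuclideanCLM (𝕜 := ℝ) M c‖ ^ 2 = ∑ i, (M *ᵥ c.ofLp) i ^ 2 := by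
  simp [EuclideanSpace.real_norm_sq_eq]

/-- The matrix whose rows with index in `I` are those of `N`, the others being those of `A`. -/
def mixRows (A N : Matrix (Fin n) (Fin n) ℝ) (I : Finset (Fin n)) : Matrix (Fin n) (Fin n) ℝ :=
  Matrix.of (I.piecewise N A)

theorem mixRows_mulVec (A N : Matrix (Fin n) (Fin n) ℝ) (I : Finset (Fin n)) (c : Fin n → ℝ)
    (i : Fin n) : (mixRows A N I *ᵥ c) i = if i ∈ I then (N *ᵥ c) i else (A *ᵥ c) i := by
  simp only [mixRows, Matrix.mulVec, Matrix.of_apply, Finset.piecewise]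
  split_ifs <;> rfl

/-- Hadamard's inequality is applied to both matrices in a basis f for which A f_j, j ∈ I, has no
component outside I. For such j the rows of A kept in the mixed matrix contribute nothing, so the
squared lengths α_j², β_j² of the two images add up to at most 1. -/
theorem abs_det_add_abs_det_mixRows_le {A N : Matrix (Fin n) (Fin n) ℝ}
    (h : ∀ c : E n, ∑ i, (A *ᵥ c.ofLp) i ^ 2 + ∑ i, (N *ᵥ c.ofLp) i ^ 2 ≤ ‖c‖ ^ 2)
    {I : Finset (Fin n)} (hI : 1 < I.card) :
    |A.det| + |(mixRows A N I).det| ≤ 1 := by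
  obtain ⟨f, hf⟩ := exists_orthonormalBasis_orthogonal A I
  set α : Fin n → ℝ := fun j => ‖Matrix.toEuclideanCLM (𝕜 := ℝ) A (f j)‖ with hα
  set β : Fin n → ℝ := fun j => ‖Matrix.toEuclideanCLM (𝕜 := ℝ) (mixRows A N I) (f j)‖ with hβ
  have hα0 : ∀ j, 0 ≤ α j := fun j => norm_nonneg _
  have hβ0 : ∀ j, 0 ≤ β j := fun j => norm_nonneg _
  have hsq : ∀ j, ∑ i, (A *ᵥ (f j).ofLp) i ^ 2 + ∑ i, (N *ᵥ (f j).ofLp) i ^ 2 ≤ 1 := fun j => by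
    simpa using h (f j)
  have hα1 : ∀ j, α j ≤ 1 := fun j => by
    refine (sq_le_one_iff₀ (hα0 j)).1 ?_
    rw [hα, norm_toEuclideanCLM_sq]
    have : 0 ≤ ∑ i, (N *ᵥ (f j).ofLp) i ^ 2 := Finset.sum_nonneg fun i _ => sq_nonneg _
    linarith [hsq j]
  have hβ1 : ∀ j, β j ≤ 1 := fun j => by
    refine (sq_le_one_iff₀ (hβ0 j)).1 ?_
    rw [hβ, norm_toEuclideanCLM_sq]
    refine le_trans ?_ (hsq j)
    rw [← Finset.sum_add_distrib]
    refine Finset.sum_le_sum fun i _ => ?_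
    rw [mixRows_mulVec]
    split_ifs <;> nlinarith [sq_nonneg ((A *ᵥ (f j).ofLp) i), sq_nonneg ((N *ᵥ (f j).ofLp) i)]
  have hαβ : ∀ j ∈ I, α j ^ 2 + β j ^ 2 ≤ 1 := fun j hj => by
    rw [hα, hβ, norm_toEuclideanCLM_sq, norm_toEuclideanCLM_sq]
    refine le_trans ?_ (hsq j)
    refine add_le_add_right (Finset.sum_le_sum fun i _ => ?_) _
    rw [mixRows_mulVec]
    split_ifs with hi
    · exact le_rfl
    · rw [hf j hj i hi]; nlinarith [sq_nonneg ((N *ᵥ (f j).ofLp) i)]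
  -- Two indices are needed: α_j α_k + β_j β_k ≤ (α_j² + α_k² + β_j² + β_k²)/2 ≤ 1, whereas a single
  -- one would only give α_j + β_j ≤ √2.
  obtain ⟨j, hj, k, hk, hjk⟩ := Finset.one_lt_card.1 hI
  have key : ∀ γ : Fin n → ℝ, (∀ j, 0 ≤ γ j) → (∀ j, γ j ≤ 1) → ∏ i, γ i ≤ γ j * γ k := by
    intro γ h0 h1
    rw [← Finset.prod_pair hjk]
    exact Finset.prod_le_prod_of_subset_of_le_one (Finset.subset_univ _) (fun i _ => h0 i)
      (fun i _ _ => h1 i)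
  have h1 := (abs_det_le_prod_norm A f).trans (key α hα0 hα1)
  have h2 := (abs_det_le_prod_norm (mixRows A N I) f).trans (key β hβ0 hβ1)
  nlinarith [hαβ j hj, hαβ k hk, sq_nonneg (α j - α k), sq_nonneg (β j - β k)]

/-- This is ρ d/dρ - 1 applied to ∑ ρ^|I| = (1 + ρ)^|R|. For empty R the truncated exponent is
harmless, its factor being 0. -/
theorem sum_powerset_card_sub_one_mul_pow {ι : Type*} (R : Finset ι) (ρ : ℝ) :
    ∑ I ∈ R.powerset, ((I.card : ℝ) - 1) * ρ ^ I.card =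
      R.card * ρ * (1 + ρ) ^ (R.card - 1) - (1 + ρ) ^ R.card := by
  classical
  have h0 : ∀ R : Finset ι, ∑ I ∈ R.powerset, ρ ^ I.card = (1 + ρ) ^ R.card := fun R => by
    have := Finset.prod_add (fun _ : ι => ρ) (fun _ => 1) R
    simp only [Finset.prod_const, one_pow, mul_one] at this
    rw [← this, add_comm]
  induction R using Finset.induction_on with
  | empty => simp
  | insert a R ha ih =>
    have h1 : ∑ I ∈ R.powerset, (((insert a I).card : ℝ) - 1) * ρ ^ (insert a I).card =
        ρ * ∑ I ∈ R.powerset, ((I.card : ℝ) - 1) * ρ ^ I.card + ρ * ∑ I ∈ R.powerset, ρ ^ I.card := by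
      rw [Finset.mul_sum, Finset.mul_sum, ← Finset.sum_add_distrib]
      refine Finset.sum_congr rfl fun I hI => ?_
      rw [Finset.card_insert_of_notMem fun h => ha (Finset.mem_powerset.1 hI h)]
      push_cast
      ring
    rw [Finset.sum_powerset_insert ha, h1, ih, h0, Finset.card_insert_of_notMem ha]
    rcases Nat.eq_zero_or_pos R.card with h | h
    · rw [h]; simp
    · obtain ⟨k, hk⟩ := Nat.exists_eq_add_of_lt h
      rw [hk]
      simp only [Nat.add_sub_cancel]
      push_cast
      ring

/-- Only the largest factor can exceed ρ, since any other satisfies cᵢ² ≤ cᵢ c_k ≤ ρ². The largest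
is paired with one other factor, which is why |I| ≥ 2 is required. -/
theorem prod_le_pow_card {ι : Type*} {c : ι → ℝ} {ρ : ℝ} (hρ : 0 ≤ ρ) (hc : ∀ i, 0 ≤ c i)
    (h : ∀ i j, i ≠ j → c i * c j ≤ ρ ^ 2) {I : Finset ι} (hI : 1 < I.card) :
    ∏ i ∈ I, c i ≤ ρ ^ I.card := by
  classical
  obtain ⟨a, ha, b, hb, hab⟩ := Finset.one_lt_card.1 hI
  obtain ⟨k, hk, hmax⟩ := I.exists_max_image c ⟨a, ha⟩
  have hle : ∀ i ∈ I.erase k, c i ≤ ρ := fun i hi => by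
    have h1 := h i k (Finset.ne_of_mem_erase hi)
    have h2 := hmax i (Finset.mem_of_mem_erase hi)
    nlinarith [hc i, hc k]
  obtain ⟨l, hl⟩ : ∃ l, l ∈ I.erase k := by
    by_cases hak : a = k
    · exact ⟨b, Finset.mem_erase.2 ⟨fun h => hab (hak.trans h.symm), hb⟩⟩
    · exact ⟨a, Finset.mem_erase.2 ⟨hak, ha⟩⟩
  have hcard : ((I.erase k).erase l).card + 2 = I.card := by
    rw [Finset.card_erase_of_mem hl, Finset.card_erase_of_mem hk]; omega
  rw [← Finset.mul_prod_erase I c hk, ← Finset.mul_prod_erase _ c hl, ← mul_assoc, ← hcard,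
    pow_add, mul_comm (ρ ^ _)]
  refine mul_le_mul (h k l (Finset.ne_of_mem_erase hl).symm) ?_
    (Finset.prod_nonneg fun i _ => hc i) (sq_nonneg _)
  rw [← Finset.prod_const]
  exact Finset.prod_le_prod (fun i _ => hc i) fun i hi => hle i (Finset.mem_of_mem_erase hi)

/-- With ρ = 1/(r - 1) and k ≥ 1 nonzero entries, the sum is at most 1 + (1 + ρ)^(k-1) ((k - 1)ρ -
1), and (k - 1)ρ ≤ 1 because k ≤ r. -/
theorem sum_card_sub_one_mul_prod_le {r : ℕ} (hr : 2 ≤ r) {c : Fin n → ℝ} (hc : ∀ i, 0 ≤ c i)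
    (h : ∀ i j, i ≠ j → c i * c j ≤ 1 / ((r : ℝ) - 1) ^ 2)
    (hcard : (Finset.univ.filter fun i => c i ≠ 0).card ≤ r) :
    ∑ I : Finset (Fin n) with 1 < I.card, ((I.card : ℝ) - 1) * ∏ i ∈ I, c i ≤ 1 := by
  have hr' : (2 : ℝ) ≤ r := by exact_mod_cast hr
  have hr1 : (0 : ℝ) < r - 1 := by linarith
  set ρ : ℝ := 1 / ((r : ℝ) - 1) with hρ
  have hρ0 : 0 ≤ ρ := by positivity
  have hρr : ((r : ℝ) - 1) * ρ = 1 := by rw [hρ]; field_simp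
  set R : Finset (Fin n) := Finset.univ.filter fun i => c i ≠ 0 with hR
  have h1 : ∑ I : Finset (Fin n) with 1 < I.card, ((I.card : ℝ) - 1) * ∏ i ∈ I, c i =
      ∑ I ∈ R.powerset with 1 < I.card, ((I.card : ℝ) - 1) * ∏ i ∈ I, c i := by
    symm
    refine Finset.sum_subset (Finset.filter_subset_filter _ (Finset.subset_univ _)) ?_
    intro I hI hI'
    have : ¬ I ⊆ R := fun hs => hI' (Finset.mem_filter.2 ⟨Finset.mem_powerset.2 hs,
      (Finset.mem_filter.1 hI).2⟩)
    obtain ⟨i, hi, hiR⟩ := Finset.not_subset.1 this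
    have hci : c i = 0 := by simpa [hR] using hiR
    rw [Finset.prod_eq_zero hi hci, mul_zero]
  have h2 : ∑ I ∈ R.powerset with 1 < I.card, ((I.card : ℝ) - 1) * ∏ i ∈ I, c i ≤
      ∑ I ∈ R.powerset with 1 < I.card, ((I.card : ℝ) - 1) * ρ ^ I.card := by
    refine Finset.sum_le_sum fun I hI => ?_
    have hI1 := (Finset.mem_filter.1 hI).2
    have : (1 : ℝ) ≤ I.card := by exact_mod_cast hI1.le
    refine mul_le_mul_of_nonneg_left ?_ (by linarith)
    exact prod_le_pow_card hρ0 hc (fun i j hij => by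
      have := h i j hij
      rwa [hρ, div_pow, one_pow]) hI1
  -- Among the sets with at most one element, singletons contribute 0 and the empty set -1.
  have h3 : ∑ I ∈ R.powerset with 1 < I.card, ((I.card : ℝ) - 1) * ρ ^ I.card =
      ∑ I ∈ R.powerset, ((I.card : ℝ) - 1) * ρ ^ I.card + 1 := by
    rw [← Finset.sum_filter_add_sum_filter_not R.powerset (fun I => 1 < I.card), add_assoc,
      left_eq_add, ← eq_neg_iff_add_eq_zero]
    rw [Finset.sum_eq_single_of_mem ∅ (by simp)]
    · simp
    · intro I hI hI0
      have hI1 := (Finset.mem_filter.1 hI).2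
      have : I.card = 1 := by
        have := Finset.card_pos.2 (Finset.nonempty_iff_ne_empty.2 hI0)
        omega
      simp [this]
  rw [h1]
  refine h2.trans ?_
  rw [h3, sum_powerset_card_sub_one_mul_pow]
  have hk : ((R.card : ℝ) - 1) * ρ ≤ 1 := by
    rw [← hρr]
    have : (R.card : ℝ) ≤ r := by exact_mod_cast hcard
    exact mul_le_mul_of_nonneg_right (by linarith) hρ0
  rcases Nat.eq_zero_or_pos R.card with h0 | h0
  · simp [h0]
  · obtain ⟨k, hk'⟩ := Nat.exists_eq_add_of_lt h0
    rw [hk'] at hk ⊢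
    simp only [Nat.add_sub_cancel, zero_add]
    push_cast at hk ⊢
    have : (0 : ℝ) ≤ (1 + ρ) ^ k := by positivity
    rw [pow_succ]
    nlinarith

/-- Expansion of a determinant along the rows. -/
theorem det_add_smul_diagonal_mul (A N : Matrix (Fin n) (Fin n) ℝ) (c : Fin n → ℝ) (t : ℝ) :
    (A + t • (Matrix.diagonal c * N)).det =
      ∑ I : Finset (Fin n), t ^ I.card * ((∏ i ∈ I, c i) * (mixRows A N I).det) := by
  have h1 : (A + t • (Matrix.diagonal c * N)).det =
      Matrix.detRowAlternating ((fun i => (t * c i) • N i) + fun i => A i) := by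
    rw [add_comm]
    congr 1
    ext i j
    simp [Matrix.diagonal_mul, mul_assoc]
  rw [h1]
  have h2 := (Matrix.detRowAlternating (n := Fin n) (R := ℝ)).toMultilinearMap.map_add_univ
    (fun i => (t * c i) • N i) (fun i => A i)
  refine h2.trans (Finset.sum_congr rfl fun I _ => ?_)
  have h3 := (Matrix.detRowAlternating (n := Fin n) (R := ℝ)).toMultilinearMap.map_piecewise_smul
    (fun i => t * c i) (I.piecewise N A) I
  have h4 : I.piecewise (fun i => (t * c i) • N i) (fun i => A i) =
      I.piecewise (fun i => (t * c i) • (I.piecewise N A) i) (I.piecewise N A) := by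
    funext i
    by_cases hi : i ∈ I <;> simp [hi, Finset.piecewise]
  rw [h4, h3, Finset.prod_mul_distrib, Finset.prod_const, smul_eq_mul, mul_assoc]
  rfl

/-- Termwise, the value plus the derivative at -1 weights the set I by (-1)^|I| (1 - |I|). The empty
set gives det A, singletons give 0, and the remaining sum is at most 1 - |det A|. -/
theorem abs_det_add_deriv_le {r : ℕ} (hr : 2 ≤ r) {c : Fin n → ℝ} (hc : ∀ i, 0 ≤ c i)
    (h : ∀ i j, i ≠ j → c i * c j ≤ 1 / ((r : ℝ) - 1) ^ 2)
    (hcard : (Finset.univ.filter fun i => c i ≠ 0).card ≤ r)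
    {A N : Matrix (Fin n) (Fin n) ℝ}
    (hAN : ∀ c : E n, ∑ i, (A *ᵥ c.ofLp) i ^ 2 + ∑ i, (N *ᵥ c.ofLp) i ^ 2 ≤ ‖c‖ ^ 2) :
    |(fun t : ℝ => (A + t • (Matrix.diagonal c * N)).det) (-1) +
      deriv (fun t : ℝ => (A + t • (Matrix.diagonal c * N)).det) (-1)| ≤ 1 := by
  have hd : HasDerivAt (fun t : ℝ => (A + t • (Matrix.diagonal c * N)).det)
      (∑ I : Finset (Fin n), (I.card * (-1) ^ (I.card - 1)) *
        ((∏ i ∈ I, c i) * (mixRows A N I).det)) (-1) := by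
    simp only [det_add_smul_diagonal_mul]
    refine HasDerivAt.fun_sum fun I _ => ?_
    exact (hasDerivAt_pow I.card (-1 : ℝ)).mul_const _
  rw [hd.deriv]
  simp only [det_add_smul_diagonal_mul]
  rw [← Finset.sum_add_distrib]
  have hterm : ∀ I : Finset (Fin n), (-1 : ℝ) ^ I.card * ((∏ i ∈ I, c i) * (mixRows A N I).det) +
      (I.card * (-1) ^ (I.card - 1)) * ((∏ i ∈ I, c i) * (mixRows A N I).det) =
      (-1) ^ I.card * (1 - I.card) * ((∏ i ∈ I, c i) * (mixRows A N I).det) := fun I => by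
    rcases Nat.eq_zero_or_pos I.card with h0 | h0
    · simp [h0]
    · obtain ⟨k, hk⟩ := Nat.exists_eq_add_of_lt h0
      rw [hk]
      simp only [Nat.add_sub_cancel, zero_add, pow_succ]
      ring
  simp only [hterm]
  have hsplit : ∑ I : Finset (Fin n), (-1 : ℝ) ^ I.card * (1 - I.card) *
        ((∏ i ∈ I, c i) * (mixRows A N I).det) =
      ∑ I : Finset (Fin n) with 1 < I.card, (-1 : ℝ) ^ I.card * (1 - I.card) *
        ((∏ i ∈ I, c i) * (mixRows A N I).det) + A.det := by
    rw [← Finset.sum_filter_add_sum_filter_not Finset.univ (fun I : Finset (Fin n) => 1 < I.card)]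
    congr 1
    rw [Finset.sum_eq_single_of_mem ∅ (by simp)]
    · simp [mixRows]
      rfl
    · intro I hI hI0
      have hI1 := (Finset.mem_filter.1 hI).2
      have : I.card = 1 := by
        have := Finset.card_pos.2 (Finset.nonempty_iff_ne_empty.2 hI0)
        omega
      simp [this]
  rw [hsplit]
  have hA : |A.det| ≤ 1 := by
    refine (abs_det_le_prod_norm A (EuclideanSpace.basisFun (Fin n) ℝ)).trans ?_
    refine Finset.prod_le_one (fun _ _ => norm_nonneg _) fun j _ => ?_
    refine (sq_le_one_iff₀ (norm_nonneg _)).1 ?_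
    rw [norm_toEuclideanCLM_sq]
    have h1 := hAN (EuclideanSpace.basisFun (Fin n) ℝ j)
    have h2 : 0 ≤ ∑ i, (N *ᵥ (EuclideanSpace.basisFun (Fin n) ℝ j).ofLp) i ^ 2 :=
      Finset.sum_nonneg fun i _ => sq_nonneg _
    have h3 : ‖EuclideanSpace.basisFun (Fin n) ℝ j‖ = 1 := by simp
    rw [h3] at h1
    linarith
  have hbound : |∑ I : Finset (Fin n) with 1 < I.card, (-1 : ℝ) ^ I.card * (1 - I.card) *
        ((∏ i ∈ I, c i) * (mixRows A N I).det)| ≤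
      (∑ I : Finset (Fin n) with 1 < I.card, ((I.card : ℝ) - 1) * ∏ i ∈ I, c i) *
        (1 - |A.det|) := by
    rw [Finset.sum_mul]
    refine (Finset.abs_sum_le_sum_abs _ _).trans (Finset.sum_le_sum fun I hI => ?_)
    have hI1 := (Finset.mem_filter.1 hI).2
    have h1 : (1 : ℝ) ≤ I.card := by exact_mod_cast hI1.le
    have h2 := abs_det_add_abs_det_mixRows_le hAN hI1
    have h3 : 0 ≤ ∏ i ∈ I, c i := Finset.prod_nonneg fun i _ => hc i
    rw [abs_mul, abs_mul, abs_mul, abs_pow, abs_neg, abs_one, one_pow, one_mul, abs_sub_comm,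
      abs_of_nonneg (by linarith : (0 : ℝ) ≤ I.card - 1), abs_of_nonneg h3, mul_assoc]
    refine mul_le_mul_of_nonneg_left ?_ (by linarith)
    exact mul_le_mul_of_nonneg_left (by linarith) h3
  have hs := sum_card_sub_one_mul_prod_le hr hc h hcard
  refine (abs_add_le _ _).trans ?_
  nlinarith

end Determinants

/-! ### Inverse square roots of positive definite matrices. -/

section InvSqrt

variable {n m : ℕ}

/-- The matrix `A^{-1/2}`. -/
noncomputable def invSqrtMatrix (A : Matrix (Fin n) (Fin n) ℝ) : Matrix (Fin n) (Fin n) ℝ :=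
  cfc (fun t : ℝ => (√t)⁻¹) A

theorem continuousOn_spectrum (A : Matrix (Fin n) (Fin n) ℝ) (f : ℝ → ℝ) :
    ContinuousOn f (spectrum ℝ A) := by
  rw [continuousOn_iff_continuous_domRestrict]
  fun_prop

theorem transpose_invSqrtMatrix (A : Matrix (Fin n) (Fin n) ℝ) :
    (invSqrtMatrix A)ᵀ = invSqrtMatrix A := by
  have h : IsSelfAdjoint (invSqrtMatrix A) := cfc_predicate _ _
  simpa [IsSelfAdjoint, star_eq_conjTranspose, conjTranspose_eq_transpose_of_trivial] using h

theorem invSqrtMatrix_mul_mul {A : Matrix (Fin n) (Fin n) ℝ} (hA : A.PosDef) :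
    invSqrtMatrix A * A * invSqrtMatrix A = 1 := by
  have hsa : IsSelfAdjoint A := hA.isHermitian
  have h1 : invSqrtMatrix A * A = cfc (fun t : ℝ => (√t)⁻¹ * t) A := by
    rw [cfc_mul (fun t : ℝ => (√t)⁻¹) (fun t => t) A (continuousOn_spectrum A _)
      (continuousOn_spectrum A _), cfc_id' ℝ A]
    rfl
  rw [h1, invSqrtMatrix, ← cfc_mul (fun t : ℝ => (√t)⁻¹ * t) (fun t => (√t)⁻¹) A
    (continuousOn_spectrum A _) (continuousOn_spectrum A _), ← cfc_one ℝ A]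
  refine cfc_congr fun t ht => ?_
  rw [hA.isHermitian.spectrum_real_eq_range_eigenvalues] at ht
  obtain ⟨i, rfl⟩ := ht
  have hp := hA.eigenvalues_pos i
  have h2 := Real.sq_sqrt hp.le
  have h3 := (Real.sqrt_pos.2 hp).ne'
  simp only [Pi.one_apply]
  field_simp
  exact h2.symm

theorem det_invSqrtMatrix_pos {A : Matrix (Fin n) (Fin n) ℝ} (hA : A.PosDef) :
    0 < (invSqrtMatrix A).det := by
  have h1 := congrArg Matrix.det (invSqrtMatrix_mul_mul hA)
  rw [det_mul, det_mul, det_one] at h1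
  have h0 : 0 ≤ (invSqrtMatrix A).det := by
    open scoped MatrixOrder in
    have : 0 ≤ invSqrtMatrix A := cfc_nonneg fun t _ => inv_nonneg.2 (Real.sqrt_nonneg t)
    exact (Matrix.nonneg_iff_posSemidef.1 this).det_nonneg
  refine lt_of_le_of_ne h0 fun h => ?_
  rw [← h] at h1
  simp at h1

theorem det_invSqrtMatrix {A : Matrix (Fin n) (Fin n) ℝ} (hA : A.PosDef) :
    (invSqrtMatrix A).det * √A.det = 1 := by
  have h1 := congrArg Matrix.det (invSqrtMatrix_mul_mul hA)
  rw [det_mul, det_mul, det_one] at h1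
  have h2 := det_invSqrtMatrix_pos hA
  have h3 := Real.sq_sqrt hA.det_pos.le
  have h4 : 0 < √A.det := Real.sqrt_pos.2 hA.det_pos
  rw [← pow_eq_one_iff_of_nonneg (by positivity) two_ne_zero, mul_pow, h3, ← h1]
  ring

/-- One polynomial interpolates t ↦ t^(-1/2) on both finite spectra, and an intertwining relation
passes to polynomials. -/
theorem mul_invSqrtMatrix_comm {A : Matrix (Fin n) (Fin n) ℝ} {B : Matrix (Fin m) (Fin m) ℝ}
    (hA : A.IsHermitian) (hB : B.IsHermitian) {S : Matrix (Fin n) (Fin m) ℝ}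
    (h : S * B = A * S) : S * invSqrtMatrix B = invSqrtMatrix A * S := by
  have hfin : (spectrum ℝ A ∪ spectrum ℝ B).Finite :=
    A.finite_real_spectrum.union B.finite_real_spectrum
  let p : Polynomial ℝ := Lagrange.interpolate hfin.toFinset id fun t => (√t)⁻¹
  have hp : ∀ t ∈ spectrum ℝ A ∪ spectrum ℝ B, (√t)⁻¹ = p.eval t := fun t ht =>
    (Lagrange.eval_interpolate_at_node (fun t : ℝ => (√t)⁻¹) (Function.injective_id.injOn)
      (hfin.mem_toFinset.2 ht)).symm
  have hA' : invSqrtMatrix A = Polynomial.aeval A p := by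
    rw [← cfc_polynomial p A hA]
    exact cfc_congr fun t ht => hp t (Or.inl ht)
  have hB' : invSqrtMatrix B = Polynomial.aeval B p := by
    rw [← cfc_polynomial p B hB]
    exact cfc_congr fun t ht => hp t (Or.inr ht)
  rw [hA', hB']
  have hpow : ∀ k : ℕ, S * B ^ k = A ^ k * S := fun k => by
    induction k with
    | zero => simp
    | succ k ih => rw [pow_succ, ← Matrix.mul_assoc, ih, Matrix.mul_assoc, h, pow_succ,
        Matrix.mul_assoc]
  induction p using Polynomial.induction_on' with
  | add p q hp hq => rw [map_add, map_add, Matrix.mul_add, Matrix.add_mul, hp, hq]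
  | monomial k a =>
    simp only [Polynomial.aeval_monomial, ← Algebra.smul_def, Matrix.smul_mul, Matrix.mul_smul, hpow]

end InvSqrt

/-! ### The isometries `L` and `Lperp` in coordinates. -/

section Pointwise

variable {n m k : ℕ} (F : E n → E m) (x : E n)

theorem posDef_one_add_transpose_mul (S : Matrix (Fin m) (Fin n) ℝ) : (1 + Sᵀ * S).PosDef := by
  have h := Matrix.posSemidef_conjTranspose_mul_self S
  rw [conjTranspose_eq_transpose_of_trivial] at h
  exact Matrix.PosDef.one.add_posSemidef h

theorem posDef_matG : (matG F x).PosDef := posDef_one_add_transpose_mul _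

theorem posDef_matH : (matH F x).PosDef := by
  simpa [matH] using posDef_one_add_transpose_mul (jacobian F x)ᵀ

theorem fderiv_ofLp (v : E n) : (fderiv ℝ F x v).ofLp = jacobian F x *ᵥ v.ofLp := by
  have h := (EuclideanSpace.basisFun (Fin n) ℝ).sum_repr v
  funext a
  conv_lhs => rw [← h]
  simp [Matrix.mulVec, dotProduct, jacobian, stdVec, mul_comm]

/-- The components `dF^* w`. -/
theorem adjoint_fderiv_ofLp (w : E m) :
    (ContinuousLinearMap.adjoint (fderiv ℝ F x) w).ofLp = (jacobian F x)ᵀ *ᵥ w.ofLp := by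
  funext i
  have h := ContinuousLinearMap.adjoint_inner_left (fderiv ℝ F x) (stdVec i) w
  have h1 : inner ℝ (ContinuousLinearMap.adjoint (fderiv ℝ F x) w) (stdVec i) =
      (ContinuousLinearMap.adjoint (fderiv ℝ F x) w) i := by
    simp [stdVec, EuclideanSpace.inner_single_right]
  rw [← h1, h]
  simp [PiLp.inner_apply, Matrix.mulVec, dotProduct, jacobian]

/-- The first component of a vector of `ℝⁿ × ℝᵐ`. -/
def fstCoord (p : V n m) : Fin n → ℝ := fun i => p (Sum.inl i)

/-- The second component of a vector of `ℝⁿ × ℝᵐ`. -/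
def sndCoord (p : V n m) : Fin m → ℝ := fun a => p (Sum.inr a)

theorem ext_coord {p q : V n m} (h1 : fstCoord p = fstCoord q) (h2 : sndCoord p = sndCoord q) :
    p = q := by
  ext i
  cases i with
  | inl i => exact congrFun h1 i
  | inr a => exact congrFun h2 a

theorem inner_eq_coord (p q : V n m) :
    inner ℝ p q = fstCoord p ⬝ᵥ fstCoord q + sndCoord p ⬝ᵥ sndCoord q := by
  simp [PiLp.inner_apply, dotProduct, fstCoord, sndCoord, mul_comm]

theorem fstCoord_L (v : E n) :
    fstCoord (L F x v) = invSqrtMatrix (matG F x) *ᵥ v.ofLp := rfl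

theorem sndCoord_L (v : E n) :
    sndCoord (L F x v) = jacobian F x *ᵥ (invSqrtMatrix (matG F x) *ᵥ v.ofLp) :=
  fderiv_ofLp F x _

theorem fstCoord_Lperp (w : E m) :
    fstCoord (Lperp F x w) = -((jacobian F x)ᵀ *ᵥ (invSqrtMatrix (matH F x) *ᵥ w.ofLp)) :=
  congrArg Neg.neg (adjoint_fderiv_ofLp F x (invSqrt (matH F x) w))

theorem sndCoord_Lperp (w : E m) :
    sndCoord (Lperp F x w) = invSqrtMatrix (matH F x) *ᵥ w.ofLp := rfl

theorem ofLp_adjoint_L (p : V n m) : (ContinuousLinearMap.adjoint (L F x) p).ofLp =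
    invSqrtMatrix (matG F x) *ᵥ (fstCoord p + (jacobian F x)ᵀ *ᵥ sndCoord p) := by
  have h : ContinuousLinearMap.adjoint (L F x) p = WithLp.toLp 2
      (invSqrtMatrix (matG F x) *ᵥ (fstCoord p + (jacobian F x)ᵀ *ᵥ sndCoord p)) := by
    refine ext_inner_right ℝ fun v => ?_
    rw [ContinuousLinearMap.adjoint_inner_left, inner_eq_coord, fstCoord_L, sndCoord_L,
      EuclideanSpace.inner_eq_star_dotProduct]
    simp only [star_trivial]
    rw [dotProduct_mulVec, dotProduct_mulVec, dotProduct_mulVec, dotProduct_comm v.ofLp,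
      ← add_dotProduct, ← add_vecMul]
    nth_rw 2 [← transpose_invSqrtMatrix]
    rw [mulVec_transpose, mulVec_transpose]
  rw [h]

theorem ofLp_adjoint_Lperp (p : V n m) : (ContinuousLinearMap.adjoint (Lperp F x) p).ofLp =
    invSqrtMatrix (matH F x) *ᵥ (sndCoord p - jacobian F x *ᵥ fstCoord p) := by
  have h : ContinuousLinearMap.adjoint (Lperp F x) p = WithLp.toLp 2
      (invSqrtMatrix (matH F x) *ᵥ (sndCoord p - jacobian F x *ᵥ fstCoord p)) := by
    refine ext_inner_right ℝ fun v => ?_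
    rw [ContinuousLinearMap.adjoint_inner_left, inner_eq_coord, fstCoord_Lperp, sndCoord_Lperp,
      EuclideanSpace.inner_eq_star_dotProduct]
    simp only [star_trivial]
    rw [dotProduct_neg, dotProduct_mulVec, dotProduct_mulVec, dotProduct_mulVec,
      dotProduct_comm v.ofLp, ← neg_dotProduct, ← add_dotProduct, ← neg_vecMul, ← add_vecMul]
    nth_rw 2 [← transpose_invSqrtMatrix]
    rw [mulVec_transpose, vecMul_transpose, sub_eq_add_neg, add_comm]
  rw [h]

theorem adjoint_L_L (v : E n) : ContinuousLinearMap.adjoint (L F x) (L F x v) = v := by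
  apply WithLp.ofLp_injective 2
  rw [ofLp_adjoint_L, fstCoord_L, sndCoord_L]
  have h := invSqrtMatrix_mul_mul (posDef_matG F x)
  calc _ = (invSqrtMatrix (matG F x) * matG F x * invSqrtMatrix (matG F x)) *ᵥ v.ofLp := by
        rw [← mulVec_mulVec, ← mulVec_mulVec]
        congr 1
        nth_rw 3 [matG]
        rw [add_mulVec, one_mulVec, mulVec_mulVec]
    _ = _ := by rw [h, one_mulVec]

theorem adjoint_Lperp_Lperp (w : E m) :
    ContinuousLinearMap.adjoint (Lperp F x) (Lperp F x w) = w := by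
  apply WithLp.ofLp_injective 2
  rw [ofLp_adjoint_Lperp, fstCoord_Lperp, sndCoord_Lperp]
  have h := invSqrtMatrix_mul_mul (posDef_matH F x)
  calc _ = (invSqrtMatrix (matH F x) * matH F x * invSqrtMatrix (matH F x)) *ᵥ w.ofLp := by
        rw [← mulVec_mulVec, ← mulVec_mulVec]
        congr 1
        nth_rw 3 [matH]
        rw [add_mulVec, one_mulVec, mulVec_neg, sub_neg_eq_add, mulVec_mulVec]
    _ = _ := by rw [h, one_mulVec]

theorem adjoint_L_Lperp (w : E m) : ContinuousLinearMap.adjoint (L F x) (Lperp F x w) = 0 := by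
  apply WithLp.ofLp_injective 2
  rw [ofLp_adjoint_L, fstCoord_Lperp, sndCoord_Lperp, neg_add_cancel, mulVec_zero]
  rfl

/-- Bessel's inequality for the orthogonal ranges of `L` and `Lperp`; that they span everything is
not needed for the comass bound. -/
theorem norm_sq_adjoint_add_le (p : V n m) :
    ‖ContinuousLinearMap.adjoint (L F x) p‖ ^ 2 +
      ‖ContinuousLinearMap.adjoint (Lperp F x) p‖ ^ 2 ≤ ‖p‖ ^ 2 := by
  set u := ContinuousLinearMap.adjoint (L F x) p with hu
  set w := ContinuousLinearMap.adjoint (Lperp F x) p with hw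
  have h1 : inner ℝ p (L F x u) = ‖u‖ ^ 2 := by
    rw [← ContinuousLinearMap.adjoint_inner_left, real_inner_self_eq_norm_sq]
  have h2 : inner ℝ p (Lperp F x w) = ‖w‖ ^ 2 := by
    rw [← ContinuousLinearMap.adjoint_inner_left, real_inner_self_eq_norm_sq]
  have h3 : ‖L F x u‖ ^ 2 = ‖u‖ ^ 2 := by
    rw [← real_inner_self_eq_norm_sq, ← ContinuousLinearMap.adjoint_inner_left, adjoint_L_L,
      real_inner_self_eq_norm_sq]
  have h4 : ‖Lperp F x w‖ ^ 2 = ‖w‖ ^ 2 := by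
    rw [← real_inner_self_eq_norm_sq, ← ContinuousLinearMap.adjoint_inner_left,
      adjoint_Lperp_Lperp, real_inner_self_eq_norm_sq]
  have h5 : inner ℝ (L F x u) (Lperp F x w) = 0 := by
    rw [← ContinuousLinearMap.adjoint_inner_right, adjoint_L_Lperp, inner_zero_right]
  have h6 := sq_nonneg ‖p - (L F x u + Lperp F x w)‖
  rw [norm_sub_sq_real, norm_add_sq_real, inner_add_right, h1, h2, h3, h4, h5] at h6
  linarith

end Pointwise

/-! ### `Ψ` as a derivation, and Θ as P(-1) + P'(-1). -/

section Psi

variable {n m k : ℕ} (F : E n → E m) (x : E n)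

theorem hasDerivAt_alternating_line {W : Type*} [NormedAddCommGroup W] [NormedSpace ℝ W]
    (ξ : W [⋀^Fin k]→L[ℝ] ℝ) (v w : Fin k → W) (t : ℝ) :
    HasDerivAt (fun t : ℝ => ξ (v + t • w))
      (∑ j, ξ (Function.update (v + t • w) j (w j))) t := by
  have h1 : HasDerivAt (fun t : ℝ => v + t • w) w t := by
    simpa using ((hasDerivAt_id t).smul_const w).const_add v
  have h2 := (ξ.hasFDerivAt (v + t • w)).comp_hasDerivAt t h1
  exact h2.congr_deriv (ContinuousMultilinearMap.linearDeriv_apply ξ.1 _ _)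

/-- The sign (-1)^j of the wedge product cancels the sign of moving e from the first slot to the
j-th. Summed over the frame, this makes `Ψ` act slot by slot. -/
theorem wedgeCovector_curryLeft_apply (α : V n m →L[ℝ] ℝ) (ξ : Form n m (k + 1)) (e : V n m)
    (v : Fin (k + 1) → V n m) :
    wedgeCovector α (ξ.curryLeft e) v = ∑ j, ξ (Function.update v j (α (v j) • e)) := by
  rw [wedgeCovector, ContinuousAlternatingMap.alternatizeUncurryFin_apply]
  refine Finset.sum_congr rfl fun j _ => ?_
  rw [ξ.map_update_smul]
  have h := ξ.toAlternatingMap.neg_one_pow_smul_map_insertNth j e (j.removeNth v)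
  rw [Fin.insertNth_removeNth] at h
  have h2 : ξ.curryLeft e (j.removeNth v) = (-1) ^ (j : ℕ) • ξ (Function.update v j e) := h.symm
  have h3 : ((-1 : ℝ) ^ (j : ℕ)) * (-1) ^ (j : ℕ) = 1 := by rw [← mul_pow]; simp
  rw [ContinuousLinearMap.smulRight_apply, ContinuousAlternatingMap.smul_apply, h2]
  simp only [zsmul_eq_mul, smul_eq_mul]
  push_cast
  linear_combination α (v j) * ξ (Function.update v j e) * h3

/-- The endomorphism `v ↦ ∑ᵢ ⟨J eᵢ, v⟩ eᵢ`, by which `Ψ` acts as a derivation. -/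
noncomputable def frameOp : V n m →L[ℝ] V n m :=
  ∑ i : Fin n, (innerSL ℝ (J F x (L F x (stdVec i)))).smulRight (L F x (stdVec i))

theorem frameOp_apply (v : V n m) :
    frameOp F x v = ∑ i : Fin n, inner ℝ (J F x (L F x (stdVec i))) v • L F x (stdVec i) := by
  simp [frameOp]

theorem J_L (u : E n) : J F x (L F x u) = Lperp F x (fderiv ℝ F x u) := by
  simp [J, adjoint_L_L]

theorem frameOp_frameOp (v : V n m) : frameOp F x (frameOp F x v) = 0 := by
  rw [frameOp_apply]
  refine Finset.sum_eq_zero fun i _ => ?_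
  rw [frameOp_apply, inner_sum, Finset.sum_eq_zero, zero_smul]
  intro k _
  rw [J_L F x (stdVec i), inner_smul_right, ← ContinuousLinearMap.adjoint_inner_left, adjoint_L_Lperp,
    inner_zero_left, mul_zero]

theorem psi_apply (ξ : Form n m k) (v : Fin k → V n m) :
    psi F x ξ v = ∑ j, ξ (Function.update v j (frameOp F x (v j))) := by
  cases k with
  | zero => simp [psi]
  | succ k =>
    simp only [psi, ContinuousAlternatingMap.sum_apply, wedgeCovector_curryLeft_apply]
    rw [Finset.sum_comm]
    refine Finset.sum_congr rfl fun j _ => ?_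
    rw [frameOp_apply]
    exact (ξ.toMultilinearMap.map_update_sum Finset.univ j _ v).symm

/-- Since N² = 0, N takes the same value N v all along the line v + t N v. So `Ψ` differentiates
along the line at every t, and can be iterated. -/
theorem hasDerivAt_frameOp_line (ξ : Form n m k) (v : Fin k → V n m) (t : ℝ) :
    HasDerivAt (fun t : ℝ => ξ (v + t • fun j => frameOp F x (v j)))
      (psi F x ξ (v + t • fun j => frameOp F x (v j))) t := by
  convert hasDerivAt_alternating_line ξ v (fun j => frameOp F x (v j)) t using 1
  rw [psi_apply]
  simp [frameOp_frameOp]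

theorem stdVol_apply (v : Fin n → E n) : stdVol n v = (Matrix.of fun i j => v j i).det := rfl

/-- The matrix of the tangential components of `v`. -/
noncomputable def tangentMatrix (v : Fin k → V n m) : Matrix (Fin n) (Fin k) ℝ :=
  Matrix.of fun i j => ContinuousLinearMap.adjoint (L F x) (v j) i

/-- The matrix of the normal components of `v`. -/
noncomputable def normalMatrix (v : Fin k → V n m) : Matrix (Fin m) (Fin k) ℝ :=
  Matrix.of fun a j => ContinuousLinearMap.adjoint (Lperp F x) (v j) a

theorem adjoint_L_frameOp (v : V n m) :
    (ContinuousLinearMap.adjoint (L F x) (frameOp F x v)).ofLp =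
      (jacobian F x)ᵀ *ᵥ (ContinuousLinearMap.adjoint (Lperp F x) v).ofLp := by
  rw [frameOp_apply, map_sum]
  funext i
  simp only [map_smul, adjoint_L_L, J_L, ← ContinuousLinearMap.adjoint_inner_right]
  rw [← adjoint_fderiv_ofLp]
  simp [stdVec, Finset.sum_apply, Pi.single_apply, EuclideanSpace.inner_single_left]

theorem volGraph_frameOp_line (v : Fin n → V n m) (t : ℝ) :
    volGraph F x (v + t • fun j => frameOp F x (v j)) =
      (tangentMatrix F x v + t • ((jacobian F x)ᵀ * normalMatrix F x v)).det := by
  rw [volGraph, ContinuousAlternatingMap.compContinuousLinearMap_apply, stdVol_apply]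
  congr 1
  ext i j
  have h := congrFun (adjoint_L_frameOp F x (v j)) i
  simp only [Matrix.of_apply, Function.comp_apply, Pi.add_apply, Pi.smul_apply, map_add, map_smul,
    PiLp.add_apply, PiLp.smul_apply, h, tangentMatrix, normalMatrix, Matrix.add_apply,
    Matrix.smul_apply]
  rfl

theorem exists_polynomial_eval_eq_det (A B : Matrix (Fin n) (Fin n) ℝ) :
    ∃ P : Polynomial ℝ, P.natDegree < n + 1 ∧ ∀ t, P.eval t = (A + t • B).det := by
  refine ⟨((Polynomial.X : Polynomial ℝ) • B.map (Polynomial.C (R := ℝ)) +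
    A.map (Polynomial.C (R := ℝ))).det, ?_, fun t => ?_⟩
  · refine Nat.lt_succ_of_le ((Polynomial.natDegree_det_X_add_C_le B A).trans_eq ?_)
    simp
  · rw [← Polynomial.coe_evalRingHom t, RingHom.map_det]
    congr 1
    ext i j
    simp [add_comm]
    ring

/-- `Ψ^ℓ(vol)` at v equals ℓ! times the ℓ-th coefficient of P, and P(-1) + P'(-1) = ∑ (-1)^ℓ (1 - ℓ)
P_ℓ. The degree of P is at most n, which matches the truncation in `Theta`. -/
theorem Theta_apply (p : V n m) (v : Fin n → V n m) :
    Theta F p v =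
      (fun t : ℝ => (tangentMatrix F (proj n m p) v +
        t • ((jacobian F (proj n m p))ᵀ * normalMatrix F (proj n m p) v)).det) (-1) +
      deriv (fun t : ℝ => (tangentMatrix F (proj n m p) v +
        t • ((jacobian F (proj n m p))ᵀ * normalMatrix F (proj n m p) v)).det) (-1) := by
  set x := proj n m p with hx
  obtain ⟨P, hdeg, hPeval⟩ := exists_polynomial_eval_eq_det (tangentMatrix F x v)
    ((jacobian F x)ᵀ * normalMatrix F x v)
  have hiter : ∀ (l : ℕ) (t : ℝ), (psi F x)^[l] (volGraph F x)
      (v + t • fun j => frameOp F x (v j)) = (Polynomial.derivative^[l] P).eval t := fun l => by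
    induction l with
    | zero => intro t; rw [Function.iterate_zero, Function.iterate_zero, id, id,
        volGraph_frameOp_line, hPeval]
    | succ l ih =>
      intro t
      have h1 := hasDerivAt_frameOp_line F x ((psi F x)^[l] (volGraph F x)) v t
      simp only [ih] at h1
      rw [Function.iterate_succ_apply', Function.iterate_succ_apply']
      exact h1.unique (Polynomial.hasDerivAt _ _)
  have hcoeff : ∀ l : ℕ, psiForm F l p v = l.factorial * P.coeff l := fun l => by
    have h1 := hiter l 0
    rw [zero_smul, add_zero, ← Polynomial.coeff_zero_eq_eval_zero,
      Polynomial.coeff_iterate_derivative, zero_add, Nat.descFactorial_self, nsmul_eq_mul] at h1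
    exact h1
  simp only [← hPeval, Polynomial.deriv]
  rw [Theta, ContinuousAlternatingMap.sub_apply, ContinuousAlternatingMap.sum_apply]
  simp only [ContinuousAlternatingMap.smul_apply, hcoeff, smul_eq_mul]
  rw [Polynomial.eval_eq_sum_range' hdeg, Polynomial.derivative_eval,
    Polynomial.sum_over_range' _ (by simp) (n + 1) hdeg, ← Finset.sum_add_distrib,
    Finset.sum_range_eq_add_Ico _ n.succ_pos]
  have : Finset.Icc 1 n = Finset.Ico 1 (n + 1) := rfl
  rw [this, sub_eq_add_neg, ← Finset.sum_neg_distrib]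
  congr 1
  · simp
  · refine Finset.sum_congr rfl fun l hl => ?_
    obtain ⟨k, rfl⟩ := Nat.exists_eq_add_of_le' (Finset.mem_Ico.1 hl).1
    have hf : ((k + 1).factorial : ℝ) ≠ 0 := by positivity
    simp only [Nat.add_sub_cancel]
    field_simp
    push_cast
    ring

end Psi

/-! ### The comass bound. -/

section Comass

variable {n m k : ℕ} (F : E n → E m) (x : E n)

theorem comass_le_one_iff (η : Form n m k) :
    comass η ≤ 1 ↔ ∀ v : Fin k → V n m, Orthonormal ℝ v → |η v| ≤ 1 := by
  simp [comass, iSup_le_iff, Real.enorm_eq_ofReal_abs]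

/-- Singular value decomposition of `T`, with the singular values that Mathlib assigns to `T`. -/
theorem exists_singular_decomposition (T : E n →ₗ[ℝ] E m) :
    ∃ (b : OrthonormalBasis (Fin n) ℝ (E n)) (w : Fin n → E m),
      (∀ i, T (b i) = T.singularValues i • w i) ∧ ∀ y, ∑ i, inner ℝ (w i) y ^ 2 ≤ ‖y‖ ^ 2 := by
  have hn : finrank ℝ (E n) = n := by simp
  set b := T.isSymmetric_adjoint_comp_self.eigenvectorBasis hn with hb
  set c : Fin n → ℝ := fun i => T.singularValues i with hc
  have hinner : ∀ i j, inner ℝ (T (b i)) (T (b j)) = if i = j then c i ^ 2 else 0 := fun i j => by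
    have h1 := T.isSymmetric_adjoint_comp_self.apply_eigenvectorBasis hn i
    rw [← LinearMap.adjoint_inner_left]
    rw [LinearMap.comp_apply] at h1
    rw [← hb] at h1
    rw [h1, inner_smul_left, orthonormal_iff_ite.1 b.orthonormal]
    simp [hc, T.sq_singularValues_fin hn]
  have hTb : ∀ i, T (b i) = c i • ((c i)⁻¹ • T (b i)) := fun i => by
    by_cases h : c i = 0
    · have h1 := hinner i i
      rw [if_pos rfl, h, zero_pow two_ne_zero, inner_self_eq_zero] at h1
      rw [h1, smul_zero, smul_zero]
    · rw [smul_inv_smul₀ h]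
  -- Where `c i = 0` the convention `0⁻¹ = 0` makes the vector zero, so Bessel's inequality holds
  -- although only the other vectors are orthonormal.
  refine ⟨b, fun i => (c i)⁻¹ • T (b i), hTb, fun y => ?_⟩
  have horth : Orthonormal ℝ fun i : {i // c i ≠ 0} => (c i)⁻¹ • T (b i) := by
    rw [orthonormal_iff_ite]
    intro i j
    rw [inner_smul_left, inner_smul_right, hinner]
    by_cases hij : i = j
    · subst hij
      have := i.2
      simp only [if_true, conj_trivial]
      field_simp
    · have : (i : Fin n) ≠ j := fun h => hij (Subtype.ext h)
      simp [hij, this]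
  have h1 := horth.sum_inner_products_le y (s := Finset.univ)
  refine le_trans (le_of_eq ?_) h1
  simp only [Real.norm_eq_abs, sq_abs]
  rw [← Finset.sum_subtype (Finset.univ.filter fun i => c i ≠ 0) (by simp)
    (fun i => inner ℝ ((c i)⁻¹ • T (b i)) y ^ 2)]
  refine (Finset.sum_filter_of_ne (p := fun i => c i ≠ 0) fun i _ h h0 => h ?_).symm
  simp [h0]

theorem sum_sq_tangentMatrix_add_le {v : Fin k → V n m} (hv : Orthonormal ℝ v) (c : E k) :
    ∑ i, (tangentMatrix F x v *ᵥ c.ofLp) i ^ 2 + ∑ a, (normalMatrix F x v *ᵥ c.ofLp) a ^ 2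
      ≤ ‖c‖ ^ 2 := by
  have h := norm_sq_adjoint_add_le F x (∑ j, c j • v j)
  have h1 : ‖∑ j, c j • v j‖ ^ 2 = ‖c‖ ^ 2 := by
    rw [← real_inner_self_eq_norm_sq, hv.inner_sum, EuclideanSpace.real_norm_sq_eq]
    simp [sq]
  rw [h1, EuclideanSpace.real_norm_sq_eq, EuclideanSpace.real_norm_sq_eq] at h
  refine le_trans (le_of_eq ?_) h
  congr 1 <;> refine Finset.sum_congr rfl fun i _ => ?_
  · simp [tangentMatrix, Matrix.mulVec, dotProduct, map_sum, mul_comm]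
  · simp [normalMatrix, Matrix.mulVec, dotProduct, map_sum, mul_comm]

theorem comass_Theta_le {r : ℕ} (hr2 : 2 ≤ r) (p : V n m)
    (hrank : finrank ℝ (LinearMap.range (fderiv ℝ F (proj n m p)).toLinearMap) ≤ r)
    (hsv : ∀ j k : ℕ, j < k → k < r →
      (fderiv ℝ F (proj n m p)).toLinearMap.singularValues j *
        (fderiv ℝ F (proj n m p)).toLinearMap.singularValues k ≤ 1 / ((r : ℝ) - 1) ^ 2) :
    comass (Theta F p) ≤ 1 := by
  rw [comass_le_one_iff]
  intro v hv
  rw [Theta_apply]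
  set x := proj n m p
  set T := (fderiv ℝ F x).toLinearMap with hT
  obtain ⟨b, w, hbw, hw⟩ := exists_singular_decomposition T
  set c : Fin n → ℝ := fun i => T.singularValues i with hc
  set Q : Matrix (Fin n) (Fin n) ℝ := Matrix.of fun i k => b i k with hQ
  set W : Matrix (Fin n) (Fin m) ℝ := Matrix.of fun i a => w i a with hW
  have hQS : Q * (jacobian F x)ᵀ = Matrix.diagonal c * W := by
    ext i a
    have h1 := congrFun (fderiv_ofLp F x (b i)) a
    have h2 : (fderiv ℝ F x (b i)) a = c i * w i a := by
      have := congrArg (fun y : E m => y a) (hbw i)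
      simpa [hT] using this
    rw [Matrix.diagonal_mul, hW, Matrix.of_apply, ← h2, h1]
    simp [Matrix.mul_apply, Matrix.mulVec, dotProduct, hQ, mul_comm]
  have hQdet : |Q.det| = 1 := by
    have h1 : Q * Qᵀ = 1 := by
      ext i j
      have := orthonormal_iff_ite.1 b.orthonormal i j
      rw [Matrix.one_apply, ← this]
      simp [Matrix.mul_apply, hQ, PiLp.inner_apply, mul_comm]
    have h2 := congrArg Matrix.det h1
    rw [det_mul, det_transpose, det_one] at h2
    rcases mul_self_eq_one_iff.1 h2 with h | h <;> simp [h]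
  have hsupp : ∀ i, r ≤ i → T.singularValues i = 0 := fun i hi =>
    T.singularValues_eq_zero_iff_le_finrank_range.2 (hrank.trans hi)
  have hc0 : ∀ i, 0 ≤ c i := fun i => T.singularValues_nonneg i
  -- The hypothesis covers indices below r; beyond the rank the singular values vanish.
  have hcc : ∀ i j : Fin n, i < j → c i * c j ≤ 1 / ((r : ℝ) - 1) ^ 2 := fun i j hij => by
    by_cases hj : (j : ℕ) < r
    · exact hsv i j hij hj
    · have : c j = 0 := hsupp j (not_lt.1 hj)
      rw [this, mul_zero]
      positivity
  have hcard : (Finset.univ.filter fun i => c i ≠ 0).card ≤ r := by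
    rw [← Finset.card_range r]
    refine Finset.card_le_card_of_injOn (fun i => (i : ℕ)) (fun i hi => ?_)
      (Fin.val_injective.injOn)
    have hi' : c i ≠ 0 := by simpa using hi
    simp only [Finset.coe_range, Set.mem_Iio]
    by_contra h
    exact hi' (hsupp i (not_lt.1 h))
  have key := abs_det_add_deriv_le hr2 hc0 (fun i j hij => by
    rcases lt_or_gt_of_ne hij with h | h
    · exact hcc i j h
    · rw [mul_comm]; exact hcc j i h) hcard
    (A := Q * tangentMatrix F x v) (N := W * normalMatrix F x v) (fun d => by
      refine le_trans (add_le_add (le_of_eq ?_) ?_) (sum_sq_tangentMatrix_add_le F x hv d)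
      · have := b.sum_sq_norm_inner_right (WithLp.toLp 2 (tangentMatrix F x v *ᵥ d.ofLp))
        rw [EuclideanSpace.real_norm_sq_eq] at this
        rw [← this]
        refine Finset.sum_congr rfl fun i _ => ?_
        rw [← Matrix.mulVec_mulVec, Real.norm_eq_abs, sq_abs]
        simp [hQ, Matrix.mulVec, dotProduct, PiLp.inner_apply, mul_comm]
      · have := hw (WithLp.toLp 2 (normalMatrix F x v *ᵥ d.ofLp))
        rw [EuclideanSpace.real_norm_sq_eq] at this
        refine le_trans (le_of_eq ?_) this
        refine Finset.sum_congr rfl fun i _ => ?_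
        rw [← Matrix.mulVec_mulVec]
        simp [hW, Matrix.mulVec, dotProduct, PiLp.inner_apply, mul_comm])
  -- Multiplying by the orthogonal matrix Q changes the polynomial only by the sign det Q.
  have hfun : (fun t : ℝ => (Q * tangentMatrix F x v +
      t • (Matrix.diagonal c * (W * normalMatrix F x v))).det) =
      fun t : ℝ => Q.det * (tangentMatrix F x v +
        t • ((jacobian F x)ᵀ * normalMatrix F x v)).det := by
    funext t
    rw [← Matrix.mul_assoc, ← hQS, Matrix.mul_assoc, ← Matrix.mul_smul, ← Matrix.mul_add, det_mul]
  rw [hfun, deriv_const_mul_field, ← mul_add, abs_mul, hQdet, one_mul] at key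
  exact key

end Comass

/-! ### Θ as the Cartan form of the area integrand. -/

section Explicit

variable {n m k : ℕ} (F : E n → E m) (x : E n)

/-- The matrix of the `ℝⁿ` components of the vectors `v`. -/
def fstMatrix (v : Fin k → V n m) : Matrix (Fin n) (Fin k) ℝ := Matrix.of fun i j => v j (Sum.inl i)

/-- The matrix of the `ℝᵐ` components of the vectors `v`. -/
def sndMatrix (v : Fin k → V n m) : Matrix (Fin m) (Fin k) ℝ := Matrix.of fun a j => v j (Sum.inr a)

theorem tangentMatrix_eq (v : Fin k → V n m) : tangentMatrix F x v =
    invSqrtMatrix (matG F x) * (fstMatrix v + (jacobian F x)ᵀ * sndMatrix v) := by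
  ext i j
  exact congrFun (ofLp_adjoint_L F x (v j)) i

theorem normalMatrix_eq (v : Fin k → V n m) : normalMatrix F x v =
    invSqrtMatrix (matH F x) * (sndMatrix v - jacobian F x * fstMatrix v) := by
  ext a j
  exact congrFun (ofLp_adjoint_Lperp F x (v j)) a

theorem transpose_jacobian_mul_invSqrtMatrix : (jacobian F x)ᵀ * invSqrtMatrix (matH F x) =
    invSqrtMatrix (matG F x) * (jacobian F x)ᵀ :=
  mul_invSqrtMatrix_comm (posDef_matG F x).isHermitian (posDef_matH F x).isHermitian (by
    simp only [matG, matH, Matrix.mul_add, Matrix.add_mul, Matrix.mul_one, Matrix.one_mul,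
      Matrix.mul_assoc])

theorem hasDerivAt_det_line (X Z : Matrix (Fin n) (Fin n) ℝ) :
    HasDerivAt (fun s : ℝ => (X + s • Z).det) (∑ i, (X.updateRow i (Z i)).det) 0 := by
  have hrow : ∀ M : Matrix (Fin n) (Fin n) ℝ, stdVol n (fun i => WithLp.toLp 2 (M i)) = M.det :=
    fun M => det_transpose M
  have h := hasDerivAt_alternating_line (stdVol n) (fun i => WithLp.toLp 2 (X i))
    (fun i => WithLp.toLp 2 (Z i)) 0
  rw [zero_smul, add_zero] at h
  convert h using 1
  · funext s
    exact (hrow _).symm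
  · refine Finset.sum_congr rfl fun i _ => ?_
    rw [← hrow]
    congr 1
    funext j
    by_cases hj : j = i
    · subst hj; simp
    · simp [hj]

/-- The area density `√det G` of the graph. -/
noncomputable def areaDensity : ℝ := √(matG F x).det

theorem areaDensity_pos : 0 < areaDensity F x := Real.sqrt_pos.2 (posDef_matG F x).det_pos

theorem areaDensity_sq : areaDensity F x ^ 2 = (matG F x).det :=
  Real.sq_sqrt (posDef_matG F x).det_pos.le

/-- Because S* H^(-1/2) = G^(-1/2) S*, the matrix in `Theta_apply` is G^(-1/2) G (X + (t + 1) Z),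
and det G^(-1/2) det G = √det G. The point t = -1 is thus Z-order zero, so value plus derivative is
the affine part in Z. -/
theorem Theta_eq_areaDensity_mul (p : V n m) (v : Fin n → V n m) :
    Theta F p v = areaDensity F (proj n m p) * ((fstMatrix v).det +
      ∑ i, ((fstMatrix v).updateRow i (((matG F (proj n m p))⁻¹ * (jacobian F (proj n m p))ᵀ *
        (sndMatrix v - jacobian F (proj n m p) * fstMatrix v)) i)).det) := by
  rw [Theta_apply]
  set x := proj n m p
  set S := jacobian F x with hS
  set X := fstMatrix v
  set Y := sndMatrix v
  set Z := (matG F x)⁻¹ * Sᵀ * (Y - S * X) with hZ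
  have hGu : IsUnit (matG F x).det := (posDef_matG F x).det_pos.ne'.isUnit
  have hGZ : matG F x * Z = Sᵀ * (Y - S * X) := by
    rw [hZ, ← Matrix.mul_assoc, ← Matrix.mul_assoc, Matrix.mul_nonsing_inv _ hGu, Matrix.one_mul]
  have hfun : ∀ t : ℝ, (tangentMatrix F x v + t • (Sᵀ * normalMatrix F x v)).det =
      areaDensity F x * (X + (t + 1) • Z).det := fun t => by
    have h1 : tangentMatrix F x v + t • (Sᵀ * normalMatrix F x v) =
        invSqrtMatrix (matG F x) * matG F x * (X + (t + 1) • Z) := by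
      rw [tangentMatrix_eq, normalMatrix_eq, ← Matrix.mul_assoc Sᵀ,
        transpose_jacobian_mul_invSqrtMatrix, Matrix.mul_assoc _ (jacobian F x)ᵀ, Matrix.mul_assoc,
        Matrix.mul_add (matG F x), Matrix.mul_smul, hGZ, ← Matrix.mul_smul, ← Matrix.mul_add]
      congr 1
      rw [matG, ← hS, Matrix.add_mul, Matrix.one_mul, Matrix.mul_assoc, add_smul, one_smul,
        Matrix.mul_sub]
      abel
    rw [h1, det_mul, det_mul]
    congr 1
    have h2 := det_invSqrtMatrix (posDef_matG F x)
    have h3 := areaDensity_sq F x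
    rw [← h3, sq, ← mul_assoc]
    rw [areaDensity] at *
    rw [h2, one_mul]
  have hd : HasDerivAt (fun t : ℝ => areaDensity F x * (X + (t + 1) • Z).det)
      (areaDensity F x * ∑ i, (X.updateRow i (Z i)).det) (-1) := by
    have h1 : HasDerivAt (fun s : ℝ => (X + s • Z).det) (∑ i, (X.updateRow i (Z i)).det)
        (-1 + 1) := by
      rw [neg_add_cancel]
      exact hasDerivAt_det_line X Z
    exact (h1.comp_add_const (-1) 1).const_mul _
  simp only [hfun, hd.deriv]
  rw [neg_add_cancel, zero_smul, add_zero, mul_add]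

/-- The momenta `√det G · G⁻¹ dF^*` of the area functional. -/
noncomputable def momentum : Matrix (Fin n) (Fin m) ℝ :=
  areaDensity F x • ((matG F x)⁻¹ * (jacobian F x)ᵀ)

/-- With C = G⁻¹S*, the row of C S X put in place i is a combination of rows of X, of which only the
i-th survives in the determinant. This yields the trace. -/
theorem Theta_eq_momentum (p : V n m) (v : Fin n → V n m) :
    Theta F p v =
      (areaDensity F (proj n m p) - (momentum F (proj n m p) * jacobian F (proj n m p)).trace) *
        (fstMatrix v).det +
      ∑ i, ∑ a, momentum F (proj n m p) i a * ((fstMatrix v).updateRow i (sndMatrix v a)).det := by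
  rw [Theta_eq_areaDensity_mul]
  set x := proj n m p
  set S := jacobian F x
  set X := fstMatrix v
  set Y := sndMatrix v
  set C := (matG F x)⁻¹ * Sᵀ with hC
  have hrow : ∀ i, (X.updateRow i ((C * (Y - S * X)) i)).det =
      ∑ a, C i a * (X.updateRow i (Y a)).det - (C * S) i i * X.det := fun i => by
    have h1 : (C * (Y - S * X)) i = ∑ a, C i a • Y a + ∑ k, (-(C * S) i k) • X k := by
      rw [Matrix.mul_sub, ← Matrix.mul_assoc]
      funext j
      simp only [Matrix.sub_apply, Pi.add_apply, Finset.sum_apply, Pi.smul_apply, smul_eq_mul,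
        neg_mul, Finset.sum_neg_distrib, ← sub_eq_add_neg]
      rfl
    rw [h1, det_updateRow_add, det_updateRow_sum]
    have h2 := (detRowAlternating (n := Fin n) (R := ℝ)).toMultilinearMap.map_update_sum
      Finset.univ i (fun a => C i a • Y a) X
    have h3 : (X.updateRow i (∑ a, C i a • Y a)).det = ∑ a, (X.updateRow i (C i a • Y a)).det := h2
    rw [h3]
    simp only [det_updateRow_smul, smul_eq_mul, neg_mul, sub_eq_add_neg]
  simp only [hrow, momentum, Matrix.smul_mul, Matrix.trace_smul, Matrix.smul_apply,
    smul_eq_mul, mul_assoc, ← Finset.mul_sum]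
  rw [Finset.sum_sub_distrib, ← Finset.sum_mul, Matrix.trace]
  simp only [Matrix.diag_apply]
  ring

end Explicit

/-! ### Restriction to the graph. -/

section Restriction

variable {n m k : ℕ} {F : E n → E m} {x : E n}

variable (n m) in
/-- The inclusion `ℝⁿ → ℝⁿ × ℝᵐ`. -/
noncomputable def inclFst : E n →L[ℝ] V n m := pairing (ContinuousLinearMap.id ℝ (E n)) 0

variable (n m) in
/-- The inclusion `ℝᵐ → ℝⁿ × ℝᵐ`. -/
noncomputable def inclSnd : E m →L[ℝ] V n m := pairing 0 (ContinuousLinearMap.id ℝ (E m))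

theorem pair_eq (u : E n) (w : E m) : pair u w = inclFst n m u + inclSnd n m w := by
  refine ext_coord ?_ ?_
  · funext i
    exact (add_zero (u i)).symm
  · funext a
    exact (zero_add (w a)).symm

theorem graphMap_eq (F : E n → E m) :
    graphMap F = fun x => inclFst n m x + inclSnd n m (F x) :=
  funext fun x => pair_eq x (F x)

theorem hasFDerivAt_graphMap (hF : DifferentiableAt ℝ F x) :
    HasFDerivAt (graphMap F) (inclFst n m + inclSnd n m ∘L fderiv ℝ F x) x := by
  rw [graphMap_eq]
  refine (inclFst n m).hasFDerivAt.add ((inclSnd n m).hasFDerivAt.comp x hF.hasFDerivAt)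

theorem fderiv_graphMap (hF : DifferentiableAt ℝ F x) (u : E n) :
    fderiv ℝ (graphMap F) x u = pair u (fderiv ℝ F x u) := by
  rw [(hasFDerivAt_graphMap hF).fderiv, pair_eq]
  rfl

/-- On tangent vectors Y = S X, so only √det G · det X remains. Orthonormality says Xᵀ G X = 1, so
its square is 1, and the orientation makes it positive. -/
theorem restrictsToVolume_Theta {Ω : Opens (E n)} (hF : ∀ x ∈ Ω, DifferentiableAt ℝ F x) :
    RestrictsToVolume F Ω (Theta F) := by
  intro x hx v hv hvo hpos
  have hp : proj n m (graphMap F x) = x := rfl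
  rw [Theta_eq_areaDensity_mul, hp]
  have hY : sndMatrix v = jacobian F x * fstMatrix v := by
    ext a j
    obtain ⟨u, hu⟩ := hv j
    have hu' : v j = pair u (fderiv ℝ F x u) := by
      rw [← fderiv_graphMap (hF x hx)]; exact hu.symm
    have h1 := congrFun (fderiv_ofLp F x u) a
    have h2 : sndMatrix v a j = (fderiv ℝ F x u) a := by
      simp [sndMatrix, hu', pair]
    rw [h2, h1]
    simp [Matrix.mul_apply, Matrix.mulVec, dotProduct, fstMatrix, hu', pair]
  rw [hY, sub_self, Matrix.mul_zero]
  have hz : ∀ i, ((fstMatrix v).updateRow i ((0 : Matrix (Fin n) (Fin n) ℝ) i)).det = 0 := fun i =>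
    det_eq_zero_of_row_eq_zero i fun j => by simp
  simp only [hz, Finset.sum_const_zero, add_zero]
  have hX : 0 < (fstMatrix v).det := hpos
  have h1 : (fstMatrix v)ᵀ * matG F x * fstMatrix v = 1 := by
    have : (fstMatrix v)ᵀ * matG F x * fstMatrix v =
        (fstMatrix v)ᵀ * fstMatrix v + (sndMatrix v)ᵀ * sndMatrix v := by
      rw [hY, matG, transpose_mul, Matrix.mul_add, Matrix.add_mul, Matrix.mul_one]
      simp only [Matrix.mul_assoc]
    rw [this]
    ext i j
    have h2 := orthonormal_iff_ite.1 hvo i j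
    rw [Matrix.one_apply, ← h2, inner_eq_coord]
    rfl
  have h2 := congrArg Matrix.det h1
  rw [det_mul, det_mul, det_transpose, det_one, ← areaDensity_sq] at h2
  rw [← pow_eq_one_iff_of_nonneg (mul_nonneg (areaDensity_pos F x).le hX.le) two_ne_zero, ← h2]
  ring

end Restriction

/-! ### Smoothness of the coefficients. -/

section Smoothness

variable {n m k : ℕ} {F : E n → E m} {Ω : Opens (E n)}

theorem contDiffOn_det {W : Type*} [NormedAddCommGroup W] [NormedSpace ℝ W] {s : Set W}
    {M : W → Matrix (Fin k) (Fin k) ℝ} (hM : ∀ i j, ContDiffOn ℝ ∞ (fun x => M x i j) s) :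
    ContDiffOn ℝ ∞ (fun x => (M x).det) s := by
  simp only [Matrix.det_apply]
  refine ContDiffOn.sum fun σ _ => ContDiffOn.const_smul _ (contDiffOn_prod fun i _ => hM _ _)

theorem contDiffOn_adjugate {W : Type*} [NormedAddCommGroup W] [NormedSpace ℝ W] {s : Set W}
    {M : W → Matrix (Fin k) (Fin k) ℝ} (hM : ∀ i j, ContDiffOn ℝ ∞ (fun x => M x i j) s)
    (i j : Fin k) : ContDiffOn ℝ ∞ (fun x => (M x).adjugate i j) s := by
  simp only [Matrix.adjugate_apply]
  refine contDiffOn_det fun a b => ?_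
  by_cases h : a = j
  · subst h
    simpa using contDiffOn_const
  · simpa [Matrix.updateRow_ne h] using hM a b

theorem contDiffOn_fderiv (hF : ContDiffOn ℝ ∞ F Ω) : ContDiffOn ℝ ∞ (fderiv ℝ F) Ω :=
  hF.fderiv_of_isOpen Ω.isOpen (by simp)

theorem contDiffOn_jacobian (hF : ContDiffOn ℝ ∞ F Ω) (a : Fin m) (j : Fin n) :
    ContDiffOn ℝ ∞ (fun x => jacobian F x a j) Ω :=
  (EuclideanSpace.proj (𝕜 := ℝ) a : E m →L[ℝ] ℝ).contDiff.comp_contDiffOn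
    ((contDiffOn_fderiv hF).clm_apply contDiffOn_const)

theorem contDiffOn_matG (hF : ContDiffOn ℝ ∞ F Ω) (i j : Fin n) :
    ContDiffOn ℝ ∞ (fun x => matG F x i j) Ω := by
  simp only [matG, Matrix.add_apply, Matrix.mul_apply, Matrix.transpose_apply]
  exact contDiffOn_const.add (ContDiffOn.sum fun a _ =>
    (contDiffOn_jacobian hF a i).mul (contDiffOn_jacobian hF a j))

theorem contDiffOn_areaDensity (hF : ContDiffOn ℝ ∞ F Ω) :
    ContDiffOn ℝ ∞ (areaDensity F) Ω :=
  (contDiffOn_det (contDiffOn_matG hF)).sqrt fun x _ => (posDef_matG F x).det_pos.ne'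

/-- The matrix `√det G · G⁻¹`. -/
noncomputable def densityMatrix (F : E n → E m) (x : E n) : Matrix (Fin n) (Fin n) ℝ :=
  areaDensity F x • (matG F x)⁻¹

theorem momentum_eq (F : E n → E m) (x : E n) :
    momentum F x = densityMatrix F x * (jacobian F x)ᵀ := by
  rw [momentum, densityMatrix, Matrix.smul_mul]

theorem adjugate_matG (F : E n → E m) (x : E n) :
    (matG F x).adjugate = areaDensity F x • densityMatrix F x := by
  have h := (posDef_matG F x).det_pos.ne'
  rw [densityMatrix, smul_smul, ← sq, areaDensity_sq, Matrix.inv_def, Ring.inverse_eq_inv',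
    smul_inv_smul₀ h]

theorem contDiffOn_densityMatrix (hF : ContDiffOn ℝ ∞ F Ω) (i j : Fin n) :
    ContDiffOn ℝ ∞ (fun x => densityMatrix F x i j) Ω := by
  have h : ∀ x, densityMatrix F x i j = (areaDensity F x)⁻¹ * (matG F x).adjugate i j := fun x => by
    rw [adjugate_matG, Matrix.smul_apply, smul_eq_mul, inv_mul_cancel_left₀ (areaDensity_pos F x).ne']
  simp only [h]
  exact ((contDiffOn_areaDensity hF).inv fun x _ => (areaDensity_pos F x).ne').mul
    (contDiffOn_adjugate (contDiffOn_matG hF) i j)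

theorem contDiffOn_momentum (hF : ContDiffOn ℝ ∞ F Ω) (i : Fin n) (a : Fin m) :
    ContDiffOn ℝ ∞ (fun x => momentum F x i a) Ω := by
  simp only [momentum_eq, Matrix.mul_apply, Matrix.transpose_apply]
  exact ContDiffOn.sum fun j _ => (contDiffOn_densityMatrix hF i j).mul (contDiffOn_jacobian hF a j)

/-- The coefficient of `dx₁ ∧ ⋯ ∧ dxₙ` in `Θ(F)`. -/
noncomputable def energyDensity (F : E n → E m) (x : E n) : ℝ :=
  areaDensity F x - (momentum F x * jacobian F x).trace

theorem contDiffOn_energyDensity (hF : ContDiffOn ℝ ∞ F Ω) :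
    ContDiffOn ℝ ∞ (energyDensity F) Ω := by
  refine (contDiffOn_areaDensity hF).sub ?_
  simp only [Matrix.trace, Matrix.diag_apply, Matrix.mul_apply]
  exact ContDiffOn.sum fun i _ => ContDiffOn.sum fun a _ =>
    (contDiffOn_momentum hF i a).mul (contDiffOn_jacobian hF a i)

/-- The linear map `(x, y) ↦ x`, with the component `xᵢ` replaced by `yₐ`. -/
noncomputable def replaceProj (i : Fin n) (a : Fin m) : V n m →L[ℝ] E n :=
  LinearMap.toContinuousLinearMap
    { toFun := fun p => WithLp.toLp 2 (Function.update (fstCoord p) i (p (Sum.inr a)))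
      map_add' := fun p q => by
        ext j
        by_cases h : j = i
        · subst h; simp
        · simp [h, fstCoord]
      map_smul' := fun c p => by
        ext j
        by_cases h : j = i
        · subst h; simp
        · simp [h, fstCoord] }

/-- The form `dx₁ ∧ ⋯ ∧ dxₙ`. -/
noncomputable def horizontalForm (n m : ℕ) : Form n m n :=
  (stdVol n).compContinuousLinearMap (proj n m)

/-- The form `dx₁ ∧ ⋯ ∧ dxₙ`, with the factor `dxᵢ` replaced by `dyₐ`. -/
noncomputable def replaceForm (i : Fin n) (a : Fin m) : Form n m n :=
  (stdVol n).compContinuousLinearMap (replaceProj i a)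

theorem horizontalForm_apply (v : Fin n → V n m) : horizontalForm n m v = (fstMatrix v).det := rfl

theorem replaceForm_apply (i : Fin n) (a : Fin m) (v : Fin n → V n m) :
    replaceForm i a v = ((fstMatrix v).updateRow i (sndMatrix v a)).det := by
  rw [replaceForm, ContinuousAlternatingMap.compContinuousLinearMap_apply, stdVol_apply]
  congr 1
  ext k j
  by_cases h : k = i
  · subst h; simp [replaceProj, sndMatrix]
  · simp [h, replaceProj, fstMatrix, fstCoord]

theorem Theta_eq (F : E n → E m) (p : V n m) :
    Theta F p = energyDensity F (proj n m p) • horizontalForm n m +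
      ∑ i, ∑ a, momentum F (proj n m p) i a • replaceForm i a := by
  ext v
  rw [Theta_eq_momentum]
  simp [ContinuousAlternatingMap.sum_apply, replaceForm_apply, horizontalForm_apply, energyDensity]

theorem contDiffOn_Theta (hF : ContDiffOn ℝ ∞ F Ω) :
    ContDiffOn ℝ ∞ (Theta F) (cylinder m Ω) := by
  have hcomp : ∀ {f : E n → ℝ}, ContDiffOn ℝ ∞ f Ω →
      ContDiffOn ℝ ∞ (fun p => f (proj n m p)) (cylinder m Ω : Set (V n m)) := fun hf =>
    hf.comp (proj n m).contDiff.contDiffOn fun p hp => hp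
  have h : Theta F = fun p => energyDensity F (proj n m p) • horizontalForm n m +
      ∑ i, ∑ a, momentum F (proj n m p) i a • replaceForm i a := funext (Theta_eq F)
  rw [h]
  exact ((hcomp (contDiffOn_energyDensity hF)).smul contDiffOn_const).add
    (ContDiffOn.sum fun i _ => ContDiffOn.sum fun a _ =>
      (hcomp (contDiffOn_momentum hF i a)).smul contDiffOn_const)

end Smoothness

/-! ### The exterior derivative of Θ. -/

section Closedness

variable {n m k : ℕ} {F : E n → E m} {Ω : Opens (E n)}

/-- The matrix `M` with the row `ρ` put on top. -/
def consRow (ρ : Fin (n + 1) → ℝ) (M : Matrix (Fin n) (Fin (n + 1)) ℝ) :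
    Matrix (Fin (n + 1)) (Fin (n + 1)) ℝ :=
  Matrix.of fun r j => Fin.cases (ρ j) (fun i => M i j) r

theorem consRow_zero (ρ : Fin (n + 1) → ℝ) (M : Matrix (Fin n) (Fin (n + 1)) ℝ)
    (j : Fin (n + 1)) : consRow ρ M 0 j = ρ j := rfl

theorem consRow_succ (ρ : Fin (n + 1) → ℝ) (M : Matrix (Fin n) (Fin (n + 1)) ℝ) (i : Fin n)
    (j : Fin (n + 1)) : consRow ρ M i.succ j = M i j := rfl

theorem sum_neg_one_pow_mul_det_submatrix (ρ : Fin (n + 1) → ℝ)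
    (M : Matrix (Fin n) (Fin (n + 1)) ℝ) :
    ∑ j : Fin (n + 1), (-1) ^ (j : ℕ) * (ρ j * (M.submatrix id j.succAbove).det) =
      (consRow ρ M).det := by
  rw [Matrix.det_succ_row_zero]
  refine Finset.sum_congr rfl fun j _ => ?_
  rw [← mul_assoc]
  rfl

theorem det_consRow_self (M : Matrix (Fin n) (Fin (n + 1)) ℝ) (k : Fin n) :
    (consRow (M.row k) M).det = 0 :=
  Matrix.det_zero_of_row_eq (Fin.succ_ne_zero k).symm rfl

/-- dx_k ∧ (dx with dxᵢ replaced by dyₐ) has a repeated factor unless k = i, when exchanging two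
factors leaves -dyₐ ∧ dx. -/
theorem det_consRow_updateRow (M : Matrix (Fin n) (Fin (n + 1)) ℝ) (y : Fin (n + 1) → ℝ)
    (k i : Fin n) :
    (consRow (M.row k) (M.updateRow i y)).det = if k = i then -(consRow y M).det else 0 := by
  split_ifs with h
  · subst h
    have h1 := Matrix.det_permute (Equiv.swap 0 k.succ) (consRow y M)
    rw [Equiv.Perm.sign_swap (Fin.succ_ne_zero k).symm] at h1
    have h2 : consRow (M.row k) (M.updateRow k y) =
        (consRow y M).submatrix (Equiv.swap 0 k.succ) id := by
      ext r j
      rw [Matrix.submatrix_apply, id]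
      refine Fin.cases ?_ (fun r => ?_) r
      · rw [Equiv.swap_apply_left, consRow_zero, consRow_succ, Matrix.row_apply]
      · by_cases hr : r = k
        · subst hr
          rw [Equiv.swap_apply_right, consRow_zero, consRow_succ, Matrix.updateRow_self]
        · rw [Equiv.swap_apply_of_ne_of_ne (Fin.succ_ne_zero r)
            (fun h => hr (Fin.succ_injective _ h)), consRow_succ, consRow_succ,
            Matrix.updateRow_ne hr]
    rw [h2, h1]
    simp
  · refine Matrix.det_zero_of_row_eq (Fin.succ_ne_zero k).symm ?_
    funext j
    rw [consRow_zero, consRow_succ, Matrix.updateRow_ne h, Matrix.row_apply]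

theorem fstMatrix_removeNth (v : Fin (n + 1) → V n m) (j : Fin (n + 1)) :
    fstMatrix (j.removeNth v) = (fstMatrix v).submatrix id j.succAbove := rfl

theorem updateRow_removeNth (v : Fin (n + 1) → V n m) (j : Fin (n + 1)) (i : Fin n) (a : Fin m) :
    (fstMatrix (j.removeNth v)).updateRow i (sndMatrix (j.removeNth v) a) =
      ((fstMatrix v).updateRow i (sndMatrix v a)).submatrix id j.succAbove := by
  ext r s
  by_cases h : r = i
  · subst h; simp; rfl
  · simp [Matrix.updateRow_ne h]; rfl

theorem fderiv_comp_proj {f : E n → ℝ} {p : V n m} (hf : DifferentiableAt ℝ f (proj n m p)) :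
    HasFDerivAt (fun q => f (proj n m q)) ((fderiv ℝ f (proj n m p)) ∘L proj n m) p :=
  hf.hasFDerivAt.comp p (proj n m).hasFDerivAt

theorem clm_apply_proj (φ : E n →L[ℝ] ℝ) (v : V n m) :
    φ (proj n m v) = ∑ k, φ (stdVec k) * v (Sum.inl k) := by
  have h := (EuclideanSpace.basisFun (Fin n) ℝ).sum_repr (proj n m v)
  conv_lhs => rw [← h]
  simp [stdVec, mul_comm]
  rfl

/-- The coefficients depend on x only. The differential of the coefficient of dx gives nothing, and
what remains is -∑ₐ (∑ᵢ ∂ᵢ pᵢₐ) dyₐ ∧ dx. -/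
theorem extDeriv_Theta (hF : ContDiffOn ℝ ∞ F Ω) {p : V n m} (hp : proj n m p ∈ Ω)
    (hdiv : ∀ a, ∑ i, fderiv ℝ (fun x => momentum F x i a) (proj n m p) (stdVec i) = 0) :
    extDeriv (Theta F) p = 0 := by
  have hdiff : ∀ {f : E n → ℝ}, ContDiffOn ℝ ∞ f Ω → DifferentiableAt ℝ f (proj n m p) := fun hf =>
    ((hf.contDiffAt (Ω.isOpen.mem_nhds hp)).differentiableAt (by simp))
  have hΘ : DifferentiableAt ℝ (Theta F) p :=
    ((contDiffOn_Theta hF).contDiffAt ((cylinder m Ω).isOpen.mem_nhds hp)).differentiableAt (by simp)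
  ext v
  rw [extDeriv_apply hΘ]
  have hderiv : ∀ j : Fin (n + 1), fderiv ℝ (fun q => Theta F q (j.removeNth v)) p (v j) =
      (∑ k, fderiv ℝ (energyDensity F) (proj n m p) (stdVec k) * fstMatrix v k j) *
        ((fstMatrix v).submatrix id j.succAbove).det +
      ∑ i, ∑ a, (∑ k, fderiv ℝ (fun x => momentum F x i a) (proj n m p) (stdVec k) *
        fstMatrix v k j) *
        (((fstMatrix v).updateRow i (sndMatrix v a)).submatrix id j.succAbove).det := fun j => by
    have h1 := ((fderiv_comp_proj (hdiff (contDiffOn_energyDensity hF))).mul_const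
      (horizontalForm n m (j.removeNth v))).add
        (HasFDerivAt.fun_sum (u := Finset.univ) fun i (_ : i ∈ Finset.univ) =>
          HasFDerivAt.fun_sum (u := Finset.univ) fun a (_ : a ∈ Finset.univ) =>
          (fderiv_comp_proj (hdiff (contDiffOn_momentum hF i a))).mul_const
            (replaceForm i a (j.removeNth v)))
    have h2 : (fun q => Theta F q (j.removeNth v)) =
        (fun q => energyDensity F (proj n m q) * horizontalForm n m (j.removeNth v)) +
        fun q => ∑ i, ∑ a, momentum F (proj n m q) i a * replaceForm i a (j.removeNth v) := by
      funext q
      simp only [Theta_eq, ContinuousAlternatingMap.add_apply, ContinuousAlternatingMap.sum_apply,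
        ContinuousAlternatingMap.smul_apply, smul_eq_mul, Pi.add_apply]
    rw [h2, h1.fderiv]
    simp only [_root_.add_apply, _root_.sum_apply,
      _root_.smul_apply, ContinuousLinearMap.comp_apply, smul_eq_mul, clm_apply_proj,
      horizontalForm_apply, replaceForm_apply, updateRow_removeNth]
    rw [fstMatrix_removeNth]
    congr 1
    · rw [mul_comm]; rfl
    · refine Finset.sum_congr rfl fun i _ => Finset.sum_congr rfl fun a _ => ?_
      rw [mul_comm]; rfl
  simp only [hderiv]
  -- Laplace expansion along the top row turns the alternating sum over removed vectors into
  -- determinants of size n + 1.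
  have hcollect : ∀ (d : Fin n → ℝ) (M : Matrix (Fin n) (Fin (n + 1)) ℝ),
      ∑ j : Fin (n + 1), (-1) ^ (j : ℕ) * ((∑ k, d k * fstMatrix v k j) *
        (M.submatrix id j.succAbove).det) =
      ∑ k, d k * (consRow ((fstMatrix v).row k) M).det := by
    intro d M
    simp only [← sum_neg_one_pow_mul_det_submatrix, Finset.mul_sum, Finset.sum_mul]
    rw [Finset.sum_comm]
    refine Finset.sum_congr rfl fun k _ => Finset.sum_congr rfl fun j _ => ?_
    rw [Matrix.row_apply]
    ring
  have hdistrib : ∀ (A : Fin (n + 1) → ℝ) (B : Fin n → Fin m → Fin (n + 1) → ℝ),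
      ∑ j : Fin (n + 1), (-1) ^ (j : ℕ) * (A j + ∑ i, ∑ a, B i a j) =
      ∑ j : Fin (n + 1), (-1) ^ (j : ℕ) * A j +
        ∑ a, ∑ i, ∑ j : Fin (n + 1), (-1) ^ (j : ℕ) * B i a j := by
    intro A B
    simp only [mul_add, Finset.sum_add_distrib, Finset.mul_sum]
    congr 1
    rw [Finset.sum_comm]
    conv_lhs => enter [2, i]; rw [Finset.sum_comm]
    rw [Finset.sum_comm]
  simp only [zsmul_eq_mul, Int.cast_pow, Int.cast_neg, Int.cast_one]
  rw [hdistrib]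
  simp only [hcollect, det_consRow_self, det_consRow_updateRow, mul_zero, Finset.sum_const_zero,
    zero_add, mul_ite, Finset.sum_ite_eq', Finset.mem_univ, if_true, mul_neg,
    Finset.sum_neg_distrib, ← Finset.sum_mul, hdiv, zero_mul, neg_zero]
  rfl

end Closedness

/-! ### The minimal surface system in divergence form. -/

section MinimalSurfaceSystem

variable {n m k : ℕ} {F : E n → E m} {Ω : Opens (E n)}

theorem contDiffOn_graphMap (hF : ContDiffOn ℝ ∞ F Ω) : ContDiffOn ℝ ∞ (graphMap F) Ω := by
  rw [graphMap_eq]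
  exact (inclFst n m).contDiff.contDiffOn.add ((inclSnd n m).contDiff.comp_contDiffOn hF)

/-- Jacobi's formula: differentiate row by row, and evaluate the determinant with a replaced row by
Cramer's rule. -/
theorem hasFDerivAt_det {M : E k → Matrix (Fin n) (Fin n) ℝ} {M' : Fin n → Fin n → E k →L[ℝ] ℝ}
    {x : E k} (hM : ∀ i j, HasFDerivAt (fun y => M y i j) (M' i j) x) :
    HasFDerivAt (fun y => (M y).det) (∑ i, ∑ j, (M x).adjugate j i • M' i j) x := by
  have hrow : ∀ M : Matrix (Fin n) (Fin n) ℝ, stdVol n (fun i => WithLp.toLp 2 (M i)) = M.det :=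
    fun M => det_transpose M
  have hrows : HasFDerivAt (fun y => fun i => (WithLp.toLp 2 (M y i) : E n))
      (ContinuousLinearMap.pi fun i => ∑ j, (M' i j).smulRight (stdVec j)) x := by
    rw [hasFDerivAt_pi]
    intro i
    have h1 : (fun y => (WithLp.toLp 2 (M y i) : E n)) = fun y => ∑ j, M y i j • stdVec j := by
      funext y
      ext a
      simp [stdVec, Finset.sum_apply, Pi.single_apply]
    rw [h1]
    exact HasFDerivAt.fun_sum fun j _ => (hM i j).smul_const _
  have h2 := (((stdVol n).hasFDerivAt (fun i => WithLp.toLp 2 (M x i))).comp x hrows)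
  have h3 : (fun y => (M y).det) = (stdVol n) ∘ (fun y => fun i => (WithLp.toLp 2 (M y i) : E n)) :=
    funext fun y => (hrow (M y)).symm
  rw [h3]
  refine h2.congr_fderiv ?_
  ext u
  rw [ContinuousLinearMap.comp_apply]
  refine (ContinuousMultilinearMap.linearDeriv_apply (stdVol n).1 _ _).trans ?_
  rw [_root_.sum_apply]
  refine Finset.sum_congr rfl fun i _ => ?_
  have h4 : Function.update (fun i => (WithLp.toLp 2 (M x i) : E n)) i
      ((ContinuousLinearMap.pi fun i => ∑ j, (M' i j).smulRight (stdVec j)) u i) =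
      fun r => WithLp.toLp 2 (((M x).updateRow i (fun j => M' i j u)) r) := by
    funext r
    by_cases hr : r = i
    · subst hr
      ext a
      simp [stdVec, Finset.sum_apply, Pi.single_apply]
    · simp [hr]
  refine (congrArg (stdVol n) h4).trans ?_
  rw [hrow, ← Matrix.cramer_transpose_apply, Matrix.cramer_eq_adjugate_mulVec,
    ← Matrix.adjugate_transpose]
  simp [Matrix.mulVec, dotProduct]

theorem transpose_densityMatrix (x : E n) : (densityMatrix F x)ᵀ = densityMatrix F x := by
  have h : (matG F x)ᵀ = matG F x := by
    simpa using (posDef_matG F x).isHermitian.eq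
  rw [densityMatrix, Matrix.transpose_smul, Matrix.transpose_nonsing_inv, h]

theorem densityMatrix_comm (x : E n) (i j : Fin n) :
    densityMatrix F x i j = densityMatrix F x j i :=
  congrFun (congrFun (transpose_densityMatrix x) j) i

theorem densityMatrix_mul_matG (x : E n) :
    densityMatrix F x * matG F x = areaDensity F x • (1 : Matrix (Fin n) (Fin n) ℝ) := by
  rw [densityMatrix, Matrix.smul_mul,
    Matrix.nonsing_inv_mul _ (posDef_matG F x).det_pos.ne'.isUnit]

/-- The coordinate frame of the graph. -/
noncomputable def frame (F : E n → E m) (j : Fin n) (x : E n) : V n m :=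
  fderiv ℝ (graphMap F) x (stdVec j)

theorem inner_frame {x : E n} (hF : DifferentiableAt ℝ F x) (j k : Fin n) :
    inner ℝ (frame F j x) (frame F k x) = matG F x j k := by
  rw [frame, frame, fderiv_graphMap hF, fderiv_graphMap hF, inner_eq_coord]
  have h1 : ∀ j, fstCoord (pair (stdVec j) (fderiv ℝ F x (stdVec j)) : V n m) =
    (stdVec j : E n).ofLp := fun _ => rfl
  have h2 : ∀ j, sndCoord (pair (stdVec j) (fderiv ℝ F x (stdVec j)) : V n m) =
    fun a => jacobian F x a j := fun _ => rfl
  rw [h1, h1, h2, h2, matG, Matrix.add_apply, Matrix.mul_apply, Matrix.one_apply]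
  congr 1
  simp [stdVec, Pi.single_apply, eq_comm]

theorem inducedMetric_eq {x : E n} (hF : DifferentiableAt ℝ F x) :
    inducedMetric F x = matG F x := by
  ext j k
  exact inner_frame hF j k

/-- Let X be the graph map, g = G and P = W g⁻¹. The divergences are the ℝᵐ components of T = ∑
∂ᵢ(P_ij ∂_j X), W times the Laplacian of X. Its normal part is W times the mean curvature, and its
tangential part vanishes for every immersion. -/
theorem sum_fderiv_momentum (hF : ContDiffOn ℝ ∞ F Ω) (hmin : IsMinimalGraph F Ω) {x : E n}
    (hx : x ∈ Ω) (a : Fin m) :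
    ∑ i, fderiv ℝ (fun y => momentum F y i a) x (stdVec i) = 0 := by
  have hnhds : (Ω : Set (E n)) ∈ nhds x := Ω.isOpen.mem_nhds hx
  have hdF : ∀ y ∈ Ω, DifferentiableAt ℝ F y := fun y hy =>
    (hF.contDiffAt (Ω.isOpen.mem_nhds hy)).differentiableAt (by simp)
  have hX := contDiffOn_graphMap hF
  have hXx : ContDiffAt ℝ ∞ (graphMap F) x := hX.contDiffAt hnhds
  have hdX : HasFDerivAt (fderiv ℝ (graphMap F)) (fderiv ℝ (fderiv ℝ (graphMap F)) x) x :=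
    ((hXx.fderiv_right (m := ∞) (by simp)).differentiableAt (by simp)).hasFDerivAt
  set D2 : Fin n → Fin n → V n m := fun i j =>
    fderiv ℝ (fderiv ℝ (graphMap F)) x (stdVec i) (stdVec j) with hD2
  have hsymm : ∀ i j, D2 i j = D2 j i := fun i j =>
    (hXx.isSymmSndFDerivAt (by simp; exact WithTop.coe_le_coe.2 le_top)).eq (stdVec i) (stdVec j)
  have hframe : ∀ j, HasFDerivAt (frame F j)
      ((fderiv ℝ (fderiv ℝ (graphMap F)) x).flip (stdVec j)) x := fun j => by
    exact (hdX.clm_apply (hasFDerivAt_const (stdVec j) x)).congr_fderiv (by ext; simp)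
  have hP : ∀ i j, HasFDerivAt (fun y => densityMatrix F y i j)
      (fderiv ℝ (fun y => densityMatrix F y i j) x) x := fun i j =>
    (((contDiffOn_densityMatrix hF i j).contDiffAt hnhds).differentiableAt (by simp)).hasFDerivAt
  have hW : HasFDerivAt (areaDensity F) (fderiv ℝ (areaDensity F) x) x :=
    (((contDiffOn_areaDensity hF).contDiffAt hnhds).differentiableAt (by simp)).hasFDerivAt
  have hg : ∀ j k, HasFDerivAt (fun y => matG F y j k)
      (fderiv ℝ (fun y => matG F y j k) x) x := fun j k =>
    (((contDiffOn_matG hF j k).contDiffAt hnhds).differentiableAt (by simp)).hasFDerivAt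
  have hg' : ∀ i j k, fderiv ℝ (fun y => matG F y j k) x (stdVec i) =
      inner ℝ (frame F j x) (D2 i k) + inner ℝ (D2 i j) (frame F k x) := fun i j k => by
    have h1 : (fun y => matG F y j k) =ᶠ[nhds x] fun y => inner ℝ (frame F j y) (frame F k y) :=
      Filter.mem_of_superset hnhds fun y hy => (inner_frame (hdF y hy) j k).symm
    rw [h1.fderiv_eq, ((hframe j).inner ℝ (hframe k)).fderiv]
    simp [fderivInnerCLM_apply, hD2]
  -- Jacobi's formula for W² = det g; the two halves of the derivative of g contribute equally by
  -- symmetry.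
  have hWk : ∀ k, fderiv ℝ (areaDensity F) x (stdVec k) =
      ∑ i, ∑ j, densityMatrix F x i j * inner ℝ (frame F j x) (D2 i k) := fun k => by
    have h1 := hasFDerivAt_det hg
    have h2 : (fun y => (matG F y).det) = fun y => areaDensity F y ^ 2 :=
      funext fun y => (areaDensity_sq F y).symm
    rw [h2] at h1
    have h3 := congrArg (fun φ : E n →L[ℝ] ℝ => φ (stdVec k)) (h1.unique (hW.pow 2))
    simp only [adjugate_matG, _root_.sum_apply, _root_.smul_apply, Matrix.smul_apply, hg',
      smul_eq_mul] at h3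
    have hne := (areaDensity_pos F x).ne'
    have h4 : ∑ i, ∑ j, densityMatrix F x j i *
        (inner ℝ (frame F i x) (D2 k j) + inner ℝ (D2 k i) (frame F j x)) =
        2 * fderiv ℝ (areaDensity F) x (stdVec k) := by
      apply mul_left_cancel₀ hne
      simp only [Finset.mul_sum]
      simp only [mul_assoc] at h3
      rw [h3]
      simp
      ring
    have h5 : ∑ i, ∑ j, densityMatrix F x j i *
        (inner ℝ (frame F i x) (D2 k j) + inner ℝ (D2 k i) (frame F j x)) =
        2 * ∑ i, ∑ j, densityMatrix F x i j * inner ℝ (frame F j x) (D2 i k) := by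
      simp only [mul_add, Finset.sum_add_distrib, two_mul]
      congr 1
      · rw [Finset.sum_comm]
        refine Finset.sum_congr rfl fun i _ => Finset.sum_congr rfl fun j _ => ?_
        rw [hsymm]
      · refine Finset.sum_congr rfl fun i _ => Finset.sum_congr rfl fun j _ => ?_
        rw [real_inner_comm, hsymm, densityMatrix_comm]
    linarith
  set T : V n m := ∑ i, ∑ j, (densityMatrix F x i j • D2 i j +
    fderiv ℝ (fun y => densityMatrix F y i j) x (stdVec i) • frame F j x) with hT
  have hmom : ∀ i, fderiv ℝ (fun y => momentum F y i a) x (stdVec i) =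
      (∑ j, (densityMatrix F x i j • D2 i j +
        fderiv ℝ (fun y => densityMatrix F y i j) x (stdVec i) • frame F j x)) (Sum.inr a) :=
      fun i => by
    have h1 : HasFDerivAt (fun y => ∑ j, densityMatrix F y i j • frame F j y) _ x :=
      HasFDerivAt.fun_sum fun j _ => (hP i j).smul (hframe j)
    have h2 := (EuclideanSpace.proj (𝕜 := ℝ) (Sum.inr a) : V n m →L[ℝ] ℝ).hasFDerivAt.comp x h1
    have h3 : (fun y => momentum F y i a) =ᶠ[nhds x]
        (EuclideanSpace.proj (𝕜 := ℝ) (Sum.inr a) : V n m →L[ℝ] ℝ) ∘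
          fun y => ∑ j, densityMatrix F y i j • frame F j y := by
      refine Filter.mem_of_superset hnhds fun y hy => ?_
      change momentum F y i a = _
      rw [momentum_eq, Matrix.mul_apply, Function.comp_apply, map_sum]
      refine Finset.sum_congr rfl fun j _ => ?_
      rw [frame, fderiv_graphMap (hdF y hy)]
      rfl
    rw [h3.fderiv_eq, h2.fderiv]
    simp [hD2]
  have hsum : ∑ i, fderiv ℝ (fun y => momentum F y i a) x (stdVec i) = T (Sum.inr a) := by
    simp only [hmom, hT]
    simp
  suffices hT0 : T = 0 by rw [hsum, hT0]; rfl
  have hframe_mem : ∀ j, frame F j x ∈ tangentSpace F x := fun j => ⟨stdVec j, rfl⟩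
  have hTmem : T ∈ tangentSpace F x := by
    -- The terms in which P is differentiated are tangent; the others project to W times the mean
    -- curvature.
    have h1 : (tangentSpace F x)ᗮ.starProjection T = 0 := by
      have h2 : ∀ j, (tangentSpace F x)ᗮ.starProjection (frame F j x) = 0 := fun j => by
        rw [Submodule.starProjection_apply_eq_zero_iff, Submodule.orthogonal_orthogonal]
        exact hframe_mem j
      simp only [hT, map_sum, map_add, map_smul, h2, smul_zero, add_zero]
      have h3 := hmin x hx
      rw [meanCurvature, inducedMetric_eq (hdF x hx)] at h3
      have h4 := congrArg (fun z => areaDensity F x • z) h3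
      simp only [smul_zero, Finset.smul_sum, smul_smul] at h4
      exact h4
    rwa [Submodule.starProjection_apply_eq_zero_iff, Submodule.orthogonal_orthogonal] at h1
  -- Differentiate P g = W · 1: the i-th row along eᵢ, summed over i. Subtracting the formula for
  -- ∂_k W leaves ⟨T, ∂_k X⟩ = 0.
  have hTperp : ∀ k, inner ℝ T (frame F k x) = 0 := fun k => by
    have h1 : ∀ i, (∑ j, (fderiv ℝ (fun y => densityMatrix F y i j) x (stdVec i) * matG F x j k +
        densityMatrix F x i j *
          (inner ℝ (frame F j x) (D2 i k) + inner ℝ (D2 i j) (frame F k x)))) =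
        if i = k then fderiv ℝ (areaDensity F) x (stdVec k) else 0 := fun i => by
      have h2 : HasFDerivAt (fun y => ∑ j, densityMatrix F y i j * matG F y j k) _ x :=
        HasFDerivAt.fun_sum fun j _ => (hP i j).mul (hg j k)
      have h3 : (fun y => ∑ j, densityMatrix F y i j * matG F y j k) =
          fun y => areaDensity F y * (1 : Matrix (Fin n) (Fin n) ℝ) i k := by
        funext y
        rw [← Matrix.mul_apply, densityMatrix_mul_matG]
        rfl
      rw [h3] at h2
      have h4 := congrArg (fun φ : E n →L[ℝ] ℝ => φ (stdVec i)) (h2.unique (hW.mul_const _))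
      simp only [_root_.sum_apply, _root_.add_apply, _root_.smul_apply, smul_eq_mul, hg'] at h4
      rw [Matrix.one_apply] at h4
      have h5 : (if i = k then (1 : ℝ) else 0) * fderiv ℝ (areaDensity F) x (stdVec i) =
          if i = k then fderiv ℝ (areaDensity F) x (stdVec k) else 0 := by
        split_ifs with h
        · rw [h, one_mul]
        · rw [zero_mul]
      rw [← h5, ← h4]
      refine Finset.sum_congr rfl fun j _ => ?_
      ring
    have h2 : ∑ i, ∑ j, (fderiv ℝ (fun y => densityMatrix F y i j) x (stdVec i) * matG F x j k +
        densityMatrix F x i j *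
          (inner ℝ (frame F j x) (D2 i k) + inner ℝ (D2 i j) (frame F k x))) =
        fderiv ℝ (areaDensity F) x (stdVec k) := by
      simp only [h1]
      simp
    rw [hWk] at h2
    simp only [hT, sum_inner, inner_add_left, inner_smul_left, inner_frame (hdF x hx),
      conj_trivial]
    simp only [mul_add, Finset.sum_add_distrib] at h2 ⊢
    linarith
  obtain ⟨u, hu⟩ := hTmem
  have hu' : T = ∑ k, u k • frame F k x := by
    have h := (EuclideanSpace.basisFun (Fin n) ℝ).sum_repr u
    rw [← hu]
    conv_lhs => rw [← h]
    simp [frame, stdVec]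
  rw [← inner_self_eq_zero (𝕜 := ℝ)]
  nth_rw 2 [hu']
  rw [inner_sum]
  refine Finset.sum_eq_zero fun k _ => ?_
  rw [inner_smul_right, hTperp, mul_zero]

end MinimalSurfaceSystem

/-! ### From calibration to area minimization. -/

section AreaMinimization

variable {n m k : ℕ} {F : E n → E m} {Ω : Opens (E n)}

/-- The `L` images of the standard basis are orthonormal, and the coordinate frame differs from them
by a factor of determinant √det G. -/
theorem abs_apply_frame_le {x : E n} (hF : DifferentiableAt ℝ F x) {η : Form n m n}
    (hη : comass η ≤ 1) :
    |η fun i => fderiv ℝ (graphMap F) x (stdVec i)| ≤ areaDensity F x := by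
  have hL : ∀ j, L F x (stdVec j) =
      fderiv ℝ (graphMap F) x (invSqrt (matG F x) (stdVec j)) := fun j => by
    rw [fderiv_graphMap hF]; rfl
  have horth : Orthonormal ℝ fun j => L F x (stdVec j) := by
    rw [orthonormal_iff_ite]
    intro i j
    rw [← ContinuousLinearMap.adjoint_inner_left, adjoint_L_L]
    exact orthonormal_iff_ite.1 (EuclideanSpace.orthonormal_single (𝕜 := ℝ) (ι := Fin n)) i j
  have h1 := comass_le_one_iff η |>.1 hη _ horth
  set ψ : E n [⋀^Fin n]→L[ℝ] ℝ := η.compContinuousLinearMap (fderiv ℝ (graphMap F) x) with hψ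
  have h2 : η (fun j => L F x (stdVec j)) = ψ fun j => invSqrt (matG F x) (stdVec j) := by
    simp only [hL]
    rfl
  have h3 := congrArg (fun f : E n [⋀^Fin n]→ₗ[ℝ] ℝ => f fun j => invSqrt (matG F x) (stdVec j))
    (ψ.toAlternatingMap.eq_smul_basis_det (EuclideanSpace.basisFun (Fin n) ℝ).toBasis)
  have h4 : (EuclideanSpace.basisFun (Fin n) ℝ).toBasis.det
      (fun j => invSqrt (matG F x) (stdVec j)) = (invSqrtMatrix (matG F x)).det := by
    change stdVol n _ = _
    rw [stdVol_apply]
    congr 1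
    ext i j
    simp [invSqrt, invSqrtMatrix, stdVec]
  have h5 : ψ.toAlternatingMap (EuclideanSpace.basisFun (Fin n) ℝ).toBasis =
      η fun i => fderiv ℝ (graphMap F) x (stdVec i) := by
    have : ((EuclideanSpace.basisFun (Fin n) ℝ).toBasis : Fin n → E n) = stdVec := by
      funext i
      simp [stdVec]
    rw [this]
    rfl
  have h6 : η (fun j => L F x (stdVec j)) = (η fun i => fderiv ℝ (graphMap F) x (stdVec i)) *
      (invSqrtMatrix (matG F x)).det := by
    rw [h2, ← h4, ← h5]
    exact h3
  have h7 := det_invSqrtMatrix_pos (posDef_matG F x)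
  rw [h6, abs_mul, abs_of_pos h7] at h1
  have h8 := det_invSqrtMatrix (posDef_matG F x)
  refine le_of_mul_le_mul_right ?_ h7
  rw [areaDensity, mul_comm √_, h8]
  exact h1

theorem Theta_apply_frame {x : E n} (hF : DifferentiableAt ℝ F x) :
    (Theta F (graphMap F x) fun i => fderiv ℝ (graphMap F) x (stdVec i)) = areaDensity F x := by
  have hp : proj n m (graphMap F x) = x := rfl
  rw [Theta_eq_areaDensity_mul, hp]
  have h1 : fstMatrix (fun i => fderiv ℝ (graphMap F) x (stdVec i)) = 1 := by
    ext i j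
    simp [fstMatrix, fderiv_graphMap hF, pair, stdVec, Matrix.one_apply, Pi.single_apply]
  have h2 : sndMatrix (fun i => fderiv ℝ (graphMap F) x (stdVec i)) = jacobian F x := by
    ext a j
    simp [sndMatrix, fderiv_graphMap hF, pair, jacobian]
  rw [h1, h2, Matrix.mul_one, sub_self, Matrix.mul_zero, det_one]
  have hz : ∀ i, ((1 : Matrix (Fin n) (Fin n) ℝ).updateRow i
      ((0 : Matrix (Fin n) (Fin n) ℝ) i)).det = 0 := fun i =>
    det_eq_zero_of_row_eq_zero i fun j => by simp
  simp [hz]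

theorem comass_smul_le {η : Form n m k} {c : ℝ} (hc : c ∈ Set.Icc (0 : ℝ) 1)
    (hη : comass η ≤ 1) : comass (c • η) ≤ 1 := by
  rw [comass_le_one_iff] at hη ⊢
  intro v hv
  rw [ContinuousAlternatingMap.smul_apply, smul_eq_mul, abs_mul, abs_of_nonneg hc.1]
  exact mul_le_one₀ hc.2 (abs_nonneg _) (hη v hv)

theorem exists_cutoff {U : Opens (V n m)} {K : Set (V n m)} (hK : IsCompact K)
    (hKU : K ⊆ U) : ∃ χ : V n m → ℝ, ContDiff ℝ ∞ χ ∧ HasCompactSupport χ ∧ tsupport χ ⊆ U ∧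
      (∀ p ∈ K, ∀ᶠ q in nhds p, χ q = 1) ∧ ∀ p, χ p ∈ Set.Icc (0 : ℝ) 1 := by
  obtain ⟨K', hK', hKK', hK'U⟩ := exists_compact_between hK U.isOpen hKU
  obtain ⟨χ, h1, h0, h01⟩ := exists_contMDiffMap_one_nhds_of_subset_interior
    (n := ⊤) (modelWithCornersSelf ℝ (V n m)) hK.isClosed hKK'
  have hsupp : tsupport χ ⊆ K' := by
    refine closure_minimal (fun p hp => ?_) hK'.isClosed
    by_contra h
    exact hp (h0 p h)
  refine ⟨χ, χ.contMDiff.contDiff, hK'.of_isClosed_subset (isClosed_tsupport _) hsupp,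
    hsupp.trans hK'U, fun p hp => ?_, h01⟩
  exact eventually_nhdsSet_iff_forall.1 h1 p hp

theorem contDiff_smul_of_tsupport_subset {U : Opens (V n m)} {χ : V n m → ℝ}
    {Θ : V n m → Form n m k} (hχ : ContDiff ℝ ∞ χ) (hsupp : tsupport χ ⊆ U)
    (hΘ : ContDiffOn ℝ ∞ Θ U) : ContDiff ℝ ∞ fun p => χ p • Θ p := by
  rw [contDiff_iff_contDiffAt]
  intro p
  by_cases hp : p ∈ U
  · exact hχ.contDiffAt.smul (hΘ.contDiffAt (U.isOpen.mem_nhds hp))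
  · have h1 : χ =ᶠ[nhds p] 0 := notMem_tsupport_iff_eventuallyEq.1 fun h => hp (hsupp h)
    refine (contDiffAt_const (c := (0 : Form n m k))).congr_of_eventuallyEq ?_
    filter_upwards [h1] with q hq
    simp [hq]

/-- The area of the piece bounds M(T) from above. It is also the value of T + ∂S on χΘ, for a cutoff
χ equal to 1 near the piece and near the support of S. -/
theorem isAreaMinimizingGraph_of_isCalibration (hF : ContDiffOn ℝ ∞ F Ω)
    (hΘ : IsCalibration (cylinder m Ω) (Theta F)) : IsAreaMinimizingGraph F Ω := by
  intro B hB hBc hBΩ S hS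
  obtain ⟨K, hK, hKU, hS⟩ := hS
  have hdF : ∀ y ∈ Ω, DifferentiableAt ℝ F y := fun y hy =>
    (hF.contDiffAt (Ω.isOpen.mem_nhds hy)).differentiableAt (by simp)
  have hBΩ' : B ⊆ Ω := subset_closure.trans hBΩ
  have hint : IntegrableOn (areaDensity F) B :=
    (((contDiffOn_areaDensity hF).continuousOn.mono hBΩ).integrableOn_compact hBc).mono_set
      subset_closure
  have hupper : mass (U := cylinder m Ω) (graphCurrent F B) ≤
      ENNReal.ofReal (∫ x in B, areaDensity F x) := by
    refine iSup₂_le fun φ hφ => ENNReal.ofReal_le_ofReal ?_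
    refine (le_abs_self _).trans ?_
    rw [← Real.norm_eq_abs, graphCurrent]
    refine norm_integral_le_of_norm_le hint (ae_restrict_of_forall_mem hB fun x hx => ?_)
    exact abs_apply_frame_le (hdF x (hBΩ' hx)) (hφ _)
  refine hupper.trans ?_
  have hgraph : ContinuousOn (graphMap F) (closure B) :=
    (contDiffOn_graphMap hF).continuousOn.mono hBΩ
  obtain ⟨χ, hχ, hχc, hχU, hχ1, hχ01⟩ := exists_cutoff (U := cylinder m Ω)
    (hK.union (hBc.image_of_continuousOn hgraph))
    (union_subset hKU (by rintro _ ⟨x, hx, rfl⟩; exact hBΩ hx))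
  let φ : TestForm (cylinder m Ω) n :=
    { toFun := fun p => χ p • Theta F p
      contDiff' := contDiff_smul_of_tsupport_subset hχ hχU hΘ.smooth
      hasCompactSupport' := hχc.smul_right
      tsupport_subset' := (tsupport_smul_subset_left χ _).trans hχU }
  have hφ : ∀ p, φ p = χ p • Theta F p := fun _ => rfl
  have hφ1 : ∀ p, comass (φ p) ≤ 1 := fun p => by
    by_cases hp : p ∈ cylinder m Ω
    · exact comass_smul_le (hχ01 p) (hΘ.comass_le p hp)
    · have : χ p = 0 := image_eq_zero_of_notMem_tsupport fun h => hp (hχU h)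
      rw [hφ, this, zero_smul, comass_le_one_iff]
      simp
  have hT : graphCurrent F B φ = ∫ x in B, areaDensity F x := by
    refine setIntegral_congr_fun hB fun x hx => ?_
    have h1 : χ (graphMap F x) = 1 :=
      (hχ1 _ (Or.inr ⟨x, subset_closure hx, rfl⟩)).self_of_nhds
    change φ (graphMap F x) _ = _
    rw [hφ, h1, one_smul, Theta_apply_frame (hdF x (hBΩ' hx))]
  -- Near K the cutoff is locally 1, so d(χΘ) = dΘ = 0 there, and S sees nothing else.
  have hbd : boundary S φ = 0 := by
    refine hS _ (Set.disjoint_left.2 fun p hp hpK => ?_)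
    revert hp
    change p ∉ tsupport φ.d
    rw [notMem_tsupport_iff_eventuallyEq]
    filter_upwards [eventually_eventually_nhds.2 (hχ1 p (Or.inl hpK)),
      (cylinder m Ω).isOpen.mem_nhds (hKU hpK)] with q hq hqU
    have h1 : (φ : V n m → Form n m n) =ᶠ[nhds q] Theta F := by
      filter_upwards [hq] with z hz
      rw [hφ, hz, one_smul]
    change extDeriv φ q = 0
    rw [h1.extDeriv_eq, hΘ.closed q hqU]
  refine le_iSup₂_of_le φ hφ1 ?_
  change _ ≤ ENNReal.ofReal (graphCurrent F B φ + boundary S φ)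
  rw [hT, hbd, add_zero]

end AreaMinimization

end GraphCalibration

theorem mainTheorem1 {n m : ℕ}
    (Ω : TopologicalSpace.Opens (EuclideanSpace ℝ (Fin n)))
    (F : EuclideanSpace ℝ (Fin n) → EuclideanSpace ℝ (Fin m))
    (hF : ContDiffOn ℝ ∞ F Ω)
    (hmin : GraphCalibration.IsMinimalGraph F Ω)
    (r : ℕ)
    (hr : IsLUB
      ((fun x => Module.finrank ℝ (LinearMap.range (fderiv ℝ F x).toLinearMap)) '' (Ω : Set _)) r)
    (hr2 : 2 ≤ r)
    (hsv : ∀ x ∈ Ω, ∀ j k : ℕ, j < k → k < r →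
      (fderiv ℝ F x).toLinearMap.singularValues j * (fderiv ℝ F x).toLinearMap.singularValues k
        ≤ 1 / ((r : ℝ) - 1) ^ 2) :
    GraphCalibration.IsCalibration (GraphCalibration.cylinder m Ω) (GraphCalibration.Theta F) ∧
      GraphCalibration.RestrictsToVolume F Ω (GraphCalibration.Theta F) ∧
      GraphCalibration.IsAreaMinimizingGraph F Ω := by
  have hcal : GraphCalibration.IsCalibration (GraphCalibration.cylinder m Ω)
      (GraphCalibration.Theta F) :=
    { smooth := GraphCalibration.contDiffOn_Theta hF
      closed := fun p hp => GraphCalibration.extDeriv_Theta hF hp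
        (GraphCalibration.sum_fderiv_momentum hF hmin hp)
      comass_le := fun p hp => GraphCalibration.comass_Theta_le F hr2 p
        (hr.1 ⟨_, hp, rfl⟩) (hsv _ hp) }
  exact ⟨hcal, GraphCalibration.restrictsToVolume_Theta fun x hx =>
    (hF.contDiffAt (Ω.isOpen.mem_nhds hx)).differentiableAt (by simp),
    GraphCalibration.isAreaMinimizingGraph_of_isCalibration hF hcal⟩
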